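/- All rings are commutative with identity, and heights and grades take values in $\mathbb{N}\cup\{\infty\}$ with $\inf\emptyset=\infty$; in particular $\operatorname{ht}(A)=\infty$ for the unit ideal of a ring $A$. **Definitions.** Let $A$ be a ring. *Koszul grade.* For a finite sequence $\underline{x}=x_1,\dots,x_r$ in $A$ with Koszul complex $\mathbb{K}_\bullet(\underline{x})$ and an $A$-module $M$, let $\operatorname{K.grade}_A(\underline{x},M)=\inf\{i\ge 0 : H^i(\operatorname{Hom}_A(\mathbb{K}_\bullet(\underline{x}),M))\ne 0\}$. For an ideal $\mathfrak{a}$ of $A$, $\operatorname{K.grade}_A(\mathfrak{a},M)$ is the supremum of $\operatorname{K.grade}_A(\underline{x},M)$ over all finite sequences $\underline{x}$ of elements of $\mathfrak{a}$. *Parameter sequences.* For $m\ge n$ let $\varphi^m_n:\mathbb{K}_\bullet(x_1^m,\dots,x_r^m)\to\mathbb{K}_\bullet(x_1^n,\dots,x_r^n)$ be the chain map $e_I\mapsto(\prod_{k\in I}x_k)^{m-n}e_I$. The sequence $\underline{x}$ is *weakly proregular* if for each $n>0$ there is $m\ge n$ such that $H_i(\varphi^m_n)=0$ for all $i\ge1$.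 It is a *parameter sequence* if it is weakly proregular, $(\underline{x})\ne A$, and $H^r_{\underline{x}}(A)_{\mathfrak{p}}\ne0$ for all primes $\mathfrak{p}\supseteq(\underline{x})$, where $H^r_{\underline{x}}$ denotes \v{C}ech cohomology. It is a *strong parameter sequence* if $r\ge1$ and $x_1,\dots,x_i$ is a parameter sequence for all $1\le i\le r$. It is a *regular sequence* if $x_i$ is a nonzerodivisor on $A/(x_1,\dots,x_{i-1})$ for $i=1,\dots,r$ and $(\underline{x})\ne A$. *Weakly associated primes.* $\operatorname{wAss}_A(M)$ is the set of primes of $A$ that are minimal over $(0:_A m)$ for some $m\in M$. For an ideal $\mathfrak{a}$, $\min(\mathfrak{a})$ is the set of primes minimal over $\mathfrak{a}$, and for $\mathfrak{a}$ finitely generated $\mu(\mathfrak{a})$ is the minimal number of generators of $\mathfrak{a}$. *Noetherian Cohen-Macaulay.* A Noetherian ring $R$ is Cohen-Macaulay if $\operatorname{depth}R_{\mathfrak{m}}=\dim R_{\mathfrak{m}}$ for every maximal ideal $\mathfrak{m}$ of $R$, the depth of a local ring being the supremum of the lengths of regular sequences in its maximal ideal. **Theorem.** Let $R$ be a Noetherian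 Cohen-Macaulay ring and let $A=R[X_1,X_2,\dots]$ be the polynomial ring in countably infinitely many variables. Then: 1. (prime ideals) $\operatorname{ht}\mathfrak{p}=\operatorname{K.grade}_A(\mathfrak{p},A)$ for every prime ideal $\mathfrak{p}$ of $A$; 2. (ideals) $\operatorname{ht}\mathfrak{a}=\operatorname{K.grade}_A(\mathfrak{a},A)$ for every ideal $\mathfrak{a}$ of $A$; 3. (Glaz) $\operatorname{ht}\mathfrak{p}=\operatorname{K.grade}_{A_{\mathfrak{p}}}(\mathfrak{p}A_{\mathfrak{p}},A_{\mathfrak{p}})$ for every prime ideal $\mathfrak{p}$ of $A$; 4. (finitely generated ideals) $\operatorname{ht}\mathfrak{a}=\operatorname{K.grade}_A(\mathfrak{a},A)$ for every finitely generated ideal $\mathfrak{a}$ of $A$; 5. (Hamilton-Marley) every strong parameter sequence on $A$ is a regular sequence on $A$; 6. (weak Bourbaki unmixed) $\min(\mathfrak{a})=\operatorname{wAss}_A(A/\mathfrak{a})$ for every finitely generated ideal $\mathfrak{a}$ of $A$ with $\operatorname{ht}\mathfrak{a}\ge\mu(\mathfrak{a})$; 7. (maximal ideals) $\operatorname{ht}\mathfrak{m}=\operatorname{K.grade}_A(\mathfrak{m},A)$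 for every maximal ideal $\mathfrak{m}$ of $A$. -/

import Mathlib

namespace NonNoethCM

noncomputable section

universe u v

/-! ### Homology of a pair of composable linear maps -/

section Homology

variable {R : Type u} [CommRing R]
variable {A B C A' B' C' : Type*}
  [AddCommGroup A] [Module R A] [AddCommGroup B] [Module R B] [AddCommGroup C] [Module R C]
  [AddCommGroup A'] [Module R A'] [AddCommGroup B'] [Module R B'] [AddCommGroup C'] [Module R C']

/-- The homology `ker g / im f` of `A --f--> B --g--> C`. -/
abbrev Homology (f : A →ₗ[R] B) (g : B →ₗ[R] C) : Type _ :=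
  LinearMap.ker g ⧸ (LinearMap.range f).submoduleOf (LinearMap.ker g)

/-- The map on homology induced by a morphism `(α, β, γ)` between two composable pairs. -/
def homologyMap {f : A →ₗ[R] B} {g : B →ₗ[R] C} {f' : A' →ₗ[R] B'} {g' : B' →ₗ[R] C'}
    (α : A →ₗ[R] A') (β : B →ₗ[R] B') (γ : C →ₗ[R] C')
    (hf : β ∘ₗ f = f' ∘ₗ α) (hg : γ ∘ₗ g = g' ∘ₗ β) : Homology f g →ₗ[R] Homology f' g' :=
  Submodule.mapQ _ _
    (β.restrict (p := LinearMap.ker g) (q := LinearMap.ker g') (fun b hb => by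
      have h := LinearMap.congr_fun hg b
      simp only [LinearMap.comp_apply, LinearMap.mem_ker] at h hb ⊢
      rw [← h, hb, map_zero]))
    (by
      rintro ⟨b, hb⟩ ⟨a, ha⟩
      refine ⟨α a, ?_⟩
      have h := LinearMap.congr_fun hf a
      simp only [LinearMap.comp_apply, Submodule.subtype_apply] at h ha
      rw [← h, ha]
      rfl)

end Homology

/-! ### The Koszul complex -/

section Koszul

variable {R : Type u} [CommRing R] {r : ℕ}

/-- The subsets of `{0, …, r - 1}` with `i` elements. -/
abbrev Subsets (r i : ℕ) : Type := {I : Finset (Fin r) // I.card = i}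

/-- `J ∪ {j}` for `j ∉ J`. -/
def Subsets.insert {i : ℕ} (J : Subsets r i) (j : {j : Fin r // j ∉ J.1}) : Subsets r (i + 1) :=
  ⟨Insert.insert j.1 J.1, by rw [Finset.card_insert_of_notMem j.2, J.2]⟩

/-- `J \ {j}` for `j ∈ J`. -/
def Subsets.erase {i : ℕ} (J : Subsets r (i + 1)) (j : {j : Fin r // j ∈ J.1}) : Subsets r i :=
  ⟨J.1.erase j.1, by rw [Finset.card_erase_of_mem j.2, J.2, Nat.add_sub_cancel]⟩

/-- The number of elements of `J` that are smaller than `j`. -/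
def position (J : Finset (Fin r)) (j : Fin r) : ℕ := (J.filter (· < j)).card

/-- The module of Koszul chains of degree `i` on `r` elements: the free module with basis `e_I`,
`I` running over the subsets of `{0, …, r - 1}` with `i` elements; a chain is the function of its
coordinates. -/
abbrev KoszulChain (R : Type u) [CommRing R] (r i : ℕ) : Type u := Subsets r i → R

/-- The Koszul differential of `x = x_0, …, x_{r-1}`:
`e_I ↦ ∑_{j ∈ I} (-1)^{#{k ∈ I : k < j}} x_j e_{I \ {j}}`, written in coordinates. -/
def koszulD (x : Fin r → R) (i : ℕ) : KoszulChain R r (i + 1) →ₗ[R] KoszulChain R r i where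
  toFun c J := ∑ j : {j : Fin r // j ∉ J.1}, (-1) ^ position J.1 j.1 * x j.1 * c (J.insert j)
  map_add' c c' := by
    funext J
    simp only [Pi.add_apply, mul_add, Finset.sum_add_distrib]
  map_smul' a c := by
    funext J
    simp only [Pi.smul_apply, smul_eq_mul, RingHom.id_apply, Finset.mul_sum]
    exact Finset.sum_congr rfl fun _ _ => by ring

/-- The Koszul homology `H_{i+1}(K_•(x))`; only positive degrees are needed. -/
abbrev KoszulHomologySucc (x : Fin r → R) (i : ℕ) : Type u :=
  Homology (koszulD x (i + 1)) (koszulD x i)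

/-- The coboundaries in degree `i` of the complex `Hom_R(K_•(x), M)`. -/
def koszulCoboundaries (x : Fin r → R) (M : Type v) [AddCommGroup M] [Module R M] :
    (i : ℕ) → Submodule R (KoszulChain R r i →ₗ[R] M)
  | 0 => ⊥
  | i + 1 => LinearMap.range (LinearMap.lcomp R M (koszulD x i))

/-- The cocycles in degree `i` of `Hom_R(K_•(x), M)`. -/
def koszulCocycles (x : Fin r → R) (M : Type v) [AddCommGroup M] [Module R M] (i : ℕ) :
    Submodule R (KoszulChain R r i →ₗ[R] M) :=
  LinearMap.ker (LinearMap.lcomp R M (koszulD x i))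

/-- The Koszul cohomology `H^i(Hom_R(K_•(x), M))`. -/
abbrev KoszulCohomology (x : Fin r → R) (M : Type v) [AddCommGroup M] [Module R M] (i : ℕ) :
    Type (max u v) :=
  koszulCocycles x M i ⧸ (koszulCoboundaries x M i).submoduleOf (koszulCocycles x M i)

/-- The Koszul grade of a finite sequence `x` on `M`: the infimum of all `i` such that
`H^i(Hom_R(K_•(x), M)) ≠ 0`. -/
def koszulGradeSeq (x : Fin r → R) (M : Type v) [AddCommGroup M] [Module R M] : ℕ∞ :=
  ⨅ (i : ℕ) (_ : Nontrivial (KoszulCohomology x M i)), (i : ℕ∞)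

/-- The Koszul grade of an ideal `a` on `M`: the supremum of the Koszul grades of the finitely
generated subideals of `a`, that is, of all finite sequences of elements of `a`. -/
def koszulGrade (a : Ideal R) (M : Type v) [AddCommGroup M] [Module R M] : ℕ∞ :=
  ⨆ (r : ℕ) (x : Fin r → R) (_ : ∀ k, x k ∈ a), koszulGradeSeq x M

/-- The map `K_i(x^m) → K_i(x^n)`, `e_I ↦ (∏_{k ∈ I} x_k)^{m-n} e_I`, for `n ≤ m`. -/
def koszulPowMap (x : Fin r → R) (m n i : ℕ) : KoszulChain R r i →ₗ[R] KoszulChain R r i where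
  toFun c I := (∏ k ∈ I.1, x k) ^ (m - n) * c I
  map_add' c c' := by
    funext I
    simp only [Pi.add_apply, mul_add]
  map_smul' a c := by
    funext I
    simp only [Pi.smul_apply, smul_eq_mul, RingHom.id_apply]
    ring

theorem koszulPowMap_comm (x : Fin r → R) {m n : ℕ} (h : n ≤ m) (i : ℕ) :
    koszulPowMap x m n i ∘ₗ koszulD (fun k => x k ^ m) i =
      koszulD (fun k => x k ^ n) i ∘ₗ koszulPowMap x m n (i + 1) := by
  refine LinearMap.ext fun c => ?_
  funext J
  simp only [LinearMap.comp_apply, koszulPowMap, koszulD, LinearMap.coe_mk, AddHom.coe_mk,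
    Finset.mul_sum]
  refine Finset.sum_congr rfl fun j _ => ?_
  have hp : ∏ k ∈ (J.insert j).1, x k = x j.1 * ∏ k ∈ J.1, x k := Finset.prod_insert j.2
  have hm : x j.1 ^ m = x j.1 ^ n * x j.1 ^ (m - n) := by rw [← pow_add, Nat.add_sub_cancel' h]
  rw [hp, hm, mul_pow]
  ring

/-- The sequence `x` is weakly proregular: for each `n > 0` there is `m ≥ n` such that the maps
`H_i(K_•(x^m)) → H_i(K_•(x^n))` are zero for all `i ≥ 1`. -/
def IsWeaklyProregular (x : Fin r → R) : Prop :=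
  ∀ n : ℕ, 0 < n → ∃ (m : ℕ) (h : n ≤ m), ∀ i : ℕ,
    (homologyMap (koszulPowMap x m n (i + 2)) (koszulPowMap x m n (i + 1)) (koszulPowMap x m n i)
        (koszulPowMap_comm x h (i + 1)) (koszulPowMap_comm x h i) :
      KoszulHomologySucc (fun k => x k ^ m) i →ₗ[R] KoszulHomologySucc (fun k => x k ^ n) i) = 0

end Koszul

/-! ### The Čech complex -/

section Cech

variable {R : Type u} [CommRing R] {r : ℕ}

/-- The localization of `R` at the product of the `x_k`, `k ∈ I`. -/
abbrev CechLoc (x : Fin r → R) (I : Finset (Fin r)) : Type u := Localization.Away (∏ k ∈ I, x k)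

/-- The module of Čech cochains of degree `i`. -/
abbrev CechCochain (x : Fin r → R) (i : ℕ) : Type u := (I : Subsets r i) → CechLoc x I.1

theorem cechLoc_isUnit (x : Fin r → R) {I J : Finset (Fin r)} (h : I ⊆ J)
    (y : Submonoid.powers (∏ k ∈ I, x k)) : IsUnit (algebraMap R (CechLoc x J) y) := by
  obtain ⟨_, n, rfl⟩ := y
  have hu : IsUnit (algebraMap R (CechLoc x J) (∏ k ∈ J, x k)) :=
    IsLocalization.Away.algebraMap_isUnit _
  have hd : (∏ k ∈ I, x k) ∣ ∏ k ∈ J, x k := Finset.prod_dvd_prod_of_subset _ _ _ h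
  simpa only [map_pow] using (isUnit_of_dvd_unit (map_dvd _ hd) hu).pow n

/-- The canonical map of `R`-algebras from the localization for `I` to that for `J ⊇ I`. -/
def cechRes (x : Fin r → R) {I J : Finset (Fin r)} (h : I ⊆ J) :
    CechLoc x I →ₐ[R] CechLoc x J :=
  IsLocalization.liftAlgHom (M := Submonoid.powers (∏ k ∈ I, x k))
    (f := Algebra.ofId R (CechLoc x J)) (cechLoc_isUnit x h)

/-- The Čech differential
`(d c)_J = ∑_{j ∈ J} (-1)^{#{k ∈ J : k < j}} c_{J \ {j}}`. -/
def cechD (x : Fin r → R) (i : ℕ) : CechCochain x i →ₗ[R] CechCochain x (i + 1) :=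
  LinearMap.pi fun J => ∑ j : {j : Fin r // j ∈ J.1},
    (-1 : R) ^ position J.1 j.1 •
      ((cechRes x (Finset.erase_subset j.1 J.1)).toLinearMap ∘ₗ
        (LinearMap.proj (J.erase j) : CechCochain x i →ₗ[R] CechLoc x (J.erase j).1))

/-- The Čech coboundaries of degree `i`. -/
def cechCoboundaries (x : Fin r → R) : (i : ℕ) → Submodule R (CechCochain x i)
  | 0 => ⊥
  | i + 1 => LinearMap.range (cechD x i)

/-- The Čech cohomology `H^i_x(R)`. -/
abbrev CechCohomology (x : Fin r → R) (i : ℕ) : Type u :=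
  LinearMap.ker (cechD x i) ⧸ (cechCoboundaries x i).submoduleOf (LinearMap.ker (cechD x i))

end Cech

/-! ### Parameter sequences and weakly associated primes -/

section Parameters

variable {R : Type u} [CommRing R]

/-- `x = x_0, …, x_{r-1}` is a parameter sequence on `R`: it is weakly proregular, `(x) ≠ R`, and
`H^r_x(R)_p ≠ 0` for all primes `p` containing `(x)`. -/
structure IsParameterSeq {r : ℕ} (x : Fin r → R) : Prop where
  weaklyProregular : IsWeaklyProregular x
  span_ne_top : Ideal.span (Set.range x) ≠ ⊤
  cech_nontrivial : ∀ (p : Ideal R) [p.IsPrime], Ideal.span (Set.range x) ≤ p →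
    Nontrivial (LocalizedModule p.primeCompl (CechCohomology x r))

/-- A strong parameter sequence: each initial segment of positive length is a parameter
sequence. -/
def IsStrongParameterSeq {r : ℕ} (x : Fin r → R) : Prop :=
  ∀ (i : ℕ) (h : i ≤ r), 1 ≤ i → IsParameterSeq (fun k : Fin i => x (Fin.castLE h k))

/-- The weakly associated primes of `M`: the primes that are minimal over `(0 :_R m)` for some
`m ∈ M`. -/
def weaklyAssociatedPrimes (R : Type u) [CommRing R] (M : Type v) [AddCommGroup M] [Module R M] :
    Set (Ideal R) :=
  {p | ∃ m : M, p ∈ (Ideal.torsionOf R M m).minimalPrimes}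

end Parameters

/-! ### Cohen-Macaulay rings -/

/-- The depth of a local ring: the supremum of the lengths of the regular sequences in the maximal
ideal. -/
def depth (A : Type u) [CommRing A] [IsLocalRing A] : ℕ∞ :=
  ⨆ (s : List A) (_ : ∀ a ∈ s, a ∈ IsLocalRing.maximalIdeal A)
    (_ : RingTheory.Sequence.IsRegular A s), (s.length : ℕ∞)

/-- The classical notion, meant for Noetherian rings: `depth R_m = dim R_m` for every maximal
ideal `m`. -/
def IsClassicalCM (R : Type u) [CommRing R] : Prop :=
  ∀ (m : Ideal R) [m.IsMaximal],
    (depth (Localization.AtPrime m) : WithBot ℕ∞) = ringKrullDim (Localization.AtPrime m)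

/-- Cohen-Macaulay in the sense of Hamilton-Marley: every strong parameter sequence (of positive
length) is a regular sequence. -/
def IsHamiltonMarleyCM (R : Type u) [CommRing R] : Prop :=
  ∀ (r : ℕ) (x : Fin r → R), 1 ≤ r → IsStrongParameterSeq x →
    RingTheory.Sequence.IsRegular R (List.ofFn x)

/-- Cohen-Macaulay in the sense of Glaz: `ht p = K.grade(p R_p, R_p)` for every prime `p`. -/
def IsGlazCM (R : Type u) [CommRing R] : Prop :=
  ∀ (p : Ideal R) [p.IsPrime],
    p.height = koszulGrade (p.map (algebraMap R (Localization.AtPrime p)))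
      (Localization.AtPrime p)

/-- Weak Bourbaki unmixed: `min(a) = wAss(R/a)` for every finitely generated ideal `a` whose
height is at least its minimal number of generators. -/
def IsWeakBourbakiUnmixed (R : Type u) [CommRing R] : Prop :=
  ∀ a : Ideal R, a.FG → (Submodule.spanFinrank a : ℕ∞) ≤ a.height →
    a.minimalPrimes = weaklyAssociatedPrimes R (R ⧸ a)

/-- Cohen-Macaulay in the sense of a class `𝒜` of ideals: `ht a = K.grade(a, R)` for all `a` in
`𝒜`. -/
def IsCMFor (R : Type u) [CommRing R] (𝒜 : Set (Ideal R)) : Prop :=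
  ∀ a ∈ 𝒜, a.height = koszulGrade a R

end

end NonNoethCM

namespace NonNoethCM

/-! ### The Koszul cochain complex in coordinates -/

section KoszulCoordinates

variable {A : Type*} [CommRing A] {r : ℕ}

/-! `A` is the directed union of the rings `S = R[X_1, …, X_k]`. Each `S` is Noetherian and
Cohen-Macaulay and `A` is a polynomial ring over it, so a question about finitely many elements of
`A` can be settled in a suitable `S` (`IsPolynomialLike`, `IsLocallyCM`).

The common tool is an ideal `J` generated by a weakly regular sequence of length `n` (`IsRegIdeal`).
In `A` such a `J` has finitely many minimal primes, all of height at most `n`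
(`IsLocallyCM.height_le`), and a prime minimal over some `(J : g)` is minimal over `J`
(`IsLocallyCM.mem_minimalPrimes_of_colon`). So an element outside these primes is regular modulo
`J`, and prime avoidance finds regular sequences of length `n` in every ideal of height at least
`n`; hence height is at most Koszul grade. Conversely, vanishing Koszul cohomology of a finite
sequence coming from `S` yields a regular sequence, which bounds the height from below
(`KoszulVanish.le_height`).

Unmixedness follows because an ideal of height at least `μ` with `μ` generators is generated by a
regular sequence. For strong parameter sequences, a member lying in a minimal prime `p` of the ideal
of its predecessors would make the top Čech cohomology vanish at `p`.

For the rings `S` the essential inequality is `KoszulVanish.height_add_le`, which bounds the height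
of associated primes; McCoy's theorem carries the property from a ring to its polynomial ring. -/

theorem position_erase_of_lt {J : Finset (Fin r)} {j k : Fin r} (hk : k ∈ J) (h : k < j) :
    position (J.erase k) j + 1 = position J j := by
  unfold position
  rw [Finset.filter_erase]
  exact Finset.card_erase_add_one (Finset.mem_filter.2 ⟨hk, h⟩)

theorem position_erase_of_not_lt {J : Finset (Fin r)} {j k : Fin r} (h : ¬ k < j) :
    position (J.erase k) j = position J j := by
  unfold position
  rw [Finset.filter_erase, Finset.erase_eq_of_notMem]
  simp [h]

theorem position_insert_of_lt {J : Finset (Fin r)} {j k : Fin r} (hk : k ∉ J) (h : k < j) :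
    position (insert k J) j = position J j + 1 := by
  rw [← position_erase_of_lt (Finset.mem_insert_self k J) h, Finset.erase_insert hk]

theorem position_insert_of_not_lt {J : Finset (Fin r)} {j k : Fin r} (hk : k ∉ J) (h : ¬ k < j) :
    position (insert k J) j = position J j := by
  rw [← position_erase_of_not_lt (J := insert k J) h, Finset.erase_insert hk]

/-- The Koszul differential on cochains of all degrees at once. -/
def cochainD (y : Fin r → A) (c : Finset (Fin r) → A) (J : Finset (Fin r)) : A :=
  ∑ j ∈ J, (-1) ^ position J j * y j * c (J.erase j)

theorem cochainD_sub (y : Fin r → A) (b c : Finset (Fin r) → A) (J : Finset (Fin r)) :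
    cochainD y (fun K => b K - c K) J = cochainD y b J - cochainD y c J := by
  simp only [cochainD, mul_sub, Finset.sum_sub_distrib]

theorem cochainD_mul_left (y : Fin r → A) (a : A) (c : Finset (Fin r) → A) (J : Finset (Fin r)) :
    cochainD y (fun K => a * c K) J = a * cochainD y c J := by
  simp only [cochainD, Finset.mul_sum]
  exact Finset.sum_congr rfl fun _ _ => by ring

theorem cochainD_sum {ι : Type*} (s : Finset ι) (y : Fin r → A) (c : ι → Finset (Fin r) → A)
    (J : Finset (Fin r)) :
    cochainD y (fun K => ∑ i ∈ s, c i K) J = ∑ i ∈ s, cochainD y (c i) J := by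
  simp only [cochainD, Finset.mul_sum]
  exact Finset.sum_comm

theorem cochainD_mem {I : Ideal A} (y : Fin r → A) {c : Finset (Fin r) → A} {J : Finset (Fin r)}
    (h : ∀ K, K.card + 1 = J.card → c K ∈ I) : cochainD y c J ∈ I :=
  I.sum_mem fun _ hj => I.mul_mem_left _ (h _ (Finset.card_erase_add_one hj))

theorem cochainD_congr (y : Fin r → A) {b c : Finset (Fin r) → A} {J : Finset (Fin r)}
    (h : ∀ K, K.card + 1 = J.card → b K = c K) : cochainD y b J = cochainD y c J :=
  Finset.sum_congr rfl fun _ hj => by rw [h _ (Finset.card_erase_add_one hj)]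

/-- Removing `j` then `k` and removing `k` then `j` give opposite signs: removing the smaller index
shifts the position of the larger by one. -/
theorem cochainD_cochainD (y : Fin r → A) (c : Finset (Fin r) → A) (J : Finset (Fin r)) :
    cochainD y (cochainD y c) J = 0 := by
  simp only [cochainD, Finset.mul_sum]
  rw [Finset.sum_sigma']
  refine Finset.sum_involution (fun p _ => ⟨p.2, p.1⟩) ?_ ?_ ?_ ?_
  · rintro ⟨j, k⟩ h
    simp only [Finset.mem_sigma, Finset.mem_erase] at h
    obtain ⟨hj, hkj, hk⟩ := h
    simp only [Finset.erase_right_comm (a := k) (b := j)]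
    rcases lt_or_gt_of_ne hkj with hlt | hlt
    · rw [← position_erase_of_lt hk hlt, position_erase_of_not_lt (not_lt_of_gt hlt)]
      ring
    · rw [← position_erase_of_lt hj hlt, position_erase_of_not_lt (not_lt_of_gt hlt)]
      ring
  · rintro ⟨j, k⟩ h _ he
    simp only [Finset.mem_sigma, Finset.mem_erase] at h
    simp only [Sigma.mk.injEq, heq_eq_eq] at he
    exact h.2.1 he.1
  · rintro ⟨j, k⟩ h
    simp only [Finset.mem_sigma, Finset.mem_erase] at h ⊢
    exact ⟨h.2.2, h.2.1.symm, h.1⟩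
  · rintro ⟨j, k⟩ _
    rfl

/-- Contraction of a cochain with the basis element `e_j`. -/
def contract (j : Fin r) (c : Finset (Fin r) → A) (J : Finset (Fin r)) : A :=
  if j ∈ J then 0 else (-1) ^ position J j * c (insert j J)

/-- Contraction is a null-homotopy of multiplication by `y j`. If `j ∈ J`, only the term at `j`
survives; otherwise the terms at `k ≠ j` cancel in pairs. -/
theorem cochainD_contract_add (y : Fin r → A) (j : Fin r) (c : Finset (Fin r) → A)
    (J : Finset (Fin r)) :
    cochainD y (contract j c) J + contract j (cochainD y c) J = y j * c J := by
  by_cases hj : j ∈ J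
  · have h1 : contract j (cochainD y c) J = 0 := if_pos hj
    rw [h1, add_zero, cochainD, Finset.sum_eq_single_of_mem j hj]
    · rw [contract, if_neg (Finset.notMem_erase j J), position_erase_of_not_lt (lt_irrefl j),
        Finset.insert_erase hj]
      linear_combination (y j * c J) * (Even.neg_one_pow (α := A) (Even.add_self (position J j)))
        - (y j * c J) * (pow_add (-1 : A) (position J j) (position J j))
    · intro k _ hkj
      rw [contract, if_pos (Finset.mem_erase.2 ⟨hkj.symm, hj⟩), mul_zero]
  · have h1 : contract j (cochainD y c) J = (-1) ^ position J j * cochainD y c (insert j J) :=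
      if_neg hj
    rw [h1, cochainD, cochainD, Finset.sum_insert hj, mul_add, Finset.mul_sum,
      Finset.erase_insert hj, position_insert_of_not_lt hj (lt_irrefl j), add_left_comm,
      ← Finset.sum_add_distrib, Finset.sum_eq_zero, add_zero]
    · linear_combination (y j * c J) * (Even.neg_one_pow (α := A) (Even.add_self (position J j)))
        - (y j * c J) * (pow_add (-1 : A) (position J j) (position J j))
    · intro k hk
      have hkj : k ≠ j := fun h => hj (h ▸ hk)
      rw [contract, if_neg (fun h => hj (Finset.mem_of_mem_erase h)),
        Finset.erase_insert_of_ne hkj.symm]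
      rcases lt_or_gt_of_ne hkj with hlt | hlt
      · rw [← position_erase_of_lt hk hlt, position_insert_of_not_lt hj (not_lt_of_gt hlt)]
        ring
      · rw [position_erase_of_not_lt (not_lt_of_gt hlt), position_insert_of_lt hj hlt]
        ring

/-- The Koszul cohomology of `y` on `A ⧸ I` vanishes in all degrees below `n`. -/
def KoszulVanish (y : Fin r → A) (I : Ideal A) (n : ℕ) : Prop :=
  ∀ c : Finset (Fin r) → A, (∀ J, J.card ≤ n → cochainD y c J ∈ I) →
    ∃ b : Finset (Fin r) → A, ∀ J, J.card < n → c J - cochainD y b J ∈ I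

variable {y : Fin r → A} {I : Ideal A} {n : ℕ}

theorem koszulVanish_zero (y : Fin r → A) (I : Ideal A) : KoszulVanish y I 0 :=
  fun _ _ => ⟨0, fun _ h => absurd h (Nat.not_lt_zero _)⟩

theorem KoszulVanish.of_succ (h : KoszulVanish y I (n + 1)) : KoszulVanish y I n := by
  intro c hc
  -- Cutting `c` off at degree `n` makes the extra cocycle condition, in degree `n + 1`, trivial.
  obtain ⟨b, hb⟩ := h (fun J => if J.card < n then c J else 0) (by
    intro J hJ
    by_cases hn : J.card ≤ n
    · rw [cochainD_congr (c := c) y fun K hK => if_pos (by omega)]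
      exact hc J hn
    · exact cochainD_mem y fun K hK => by rw [if_neg (by omega)]; exact I.zero_mem)
  refine ⟨b, fun J hJ => ?_⟩
  simpa only [if_pos hJ] using hb J (by omega)

theorem KoszulVanish.mono {m : ℕ} (h : KoszulVanish y I n) (hm : m ≤ n) : KoszulVanish y I m := by
  induction hm with
  | refl => exact h
  | step _ ih => exact ih h.of_succ

theorem KoszulVanish.mem_of_one (h : KoszulVanish y I 1) {g : A} (hg : ∀ j, y j * g ∈ I) :
    g ∈ I := by
  obtain ⟨b, hb⟩ := h (fun _ => g) fun J _ => I.sum_mem fun j _ => by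
    rw [mul_assoc]
    exact I.mul_mem_left _ (hg j)
  simpa [cochainD] using hb ∅ (by simp)

/-- Passing to the quotient by a nonzerodivisor lowers the range of vanishing by one. -/
theorem KoszulVanish.sup_span_singleton (h : KoszulVanish y I (n + 1)) {z : A}
    (hz : ∀ g, z * g ∈ I → g ∈ I) : KoszulVanish y (I ⊔ Ideal.span {z}) n := by
  intro c hc
  -- Connecting map: modulo `I`, `dc = z e`. As `z` is regular, `e` is a cocycle, so `e = df`, and
  -- `c - z f` is a cocycle modulo `I`.
  have hex : ∀ J : Finset (Fin r), ∃ e : A, J.card ≤ n → cochainD y c J - z * e ∈ I := by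
    intro J
    by_cases hJ : J.card ≤ n
    · obtain ⟨u, hu, v, hv, huv⟩ := Submodule.mem_sup.1 (hc J hJ)
      obtain ⟨e, rfl⟩ := Ideal.mem_span_singleton'.1 hv
      refine ⟨e, fun _ => ?_⟩
      rw [← huv, mul_comm z e, add_sub_cancel_right]
      exact hu
    · exact ⟨0, fun h => absurd h hJ⟩
  choose e he using hex
  obtain ⟨f, hf⟩ := h e (by
    intro J hJ
    apply hz
    have h1 : cochainD y (fun K => cochainD y c K - z * e K) J ∈ I :=
      cochainD_mem y fun K hK => he K (by omega)
    rw [cochainD_sub, cochainD_cochainD, cochainD_mul_left, zero_sub] at h1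
    exact (Submodule.neg_mem_iff I).1 h1)
  obtain ⟨b, hb⟩ := h.of_succ (fun K => c K - z * f K) (by
    intro J hJ
    rw [cochainD_sub, cochainD_mul_left]
    have h1 := I.add_mem (he J hJ) (I.mul_mem_left z (hf J (by omega)))
    convert h1 using 1
    ring)
  refine ⟨b, fun J hJ => ?_⟩
  have h1 : z * f J ∈ Ideal.span {z} := Ideal.mul_mem_right _ _ (Ideal.mem_span_singleton_self z)
  have h2 := (I ⊔ Ideal.span {z}).add_mem (Ideal.mem_sup_left (hb J hJ)) (Ideal.mem_sup_right h1)
  convert h2 using 1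
  ring

/-- A nonzerodivisor in the ideal generated by `y` raises the range of vanishing by one. -/
theorem KoszulVanish.of_sup_span_singleton {z : A}
    (h : KoszulVanish y (I ⊔ Ideal.span {z}) n) (hzy : z ∈ Ideal.span (Set.range y))
    (hz : ∀ g, z * g ∈ I → g ∈ I) : KoszulVanish y I (n + 1) := by
  intro c hc
  obtain ⟨a, ha⟩ := (Ideal.mem_span_range_iff_exists_fun).1 hzy
  -- With `z = ∑ a j * y j`, the homotopy formula gives `z c = db` modulo `I`. So `b` is a cocycle
  -- modulo `I ⊔ (z)`, whence `b = dg + z e` modulo `I`; applying `d` gives `z (c - de) ∈ I`.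
  let b : Finset (Fin r) → A := fun J => ∑ j, a j * contract j c J
  have hb : ∀ J : Finset (Fin r), J.card ≤ n → z * c J - cochainD y b J ∈ I := by
    intro J hJ
    have h1 : z * c J - cochainD y b J = ∑ j, a j * contract j (cochainD y c) J := by
      rw [cochainD_sum, ← ha, Finset.sum_mul, ← Finset.sum_sub_distrib]
      refine Finset.sum_congr rfl fun j _ => ?_
      rw [cochainD_mul_left, mul_assoc, ← cochainD_contract_add]
      ring
    rw [h1]
    refine I.sum_mem fun j _ => I.mul_mem_left _ ?_
    unfold contract
    split_ifs with hj
    · exact I.zero_mem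
    · exact I.mul_mem_left _ (hc _ (by rw [Finset.card_insert_of_notMem hj]; omega))
  obtain ⟨g, hg⟩ := h b (by
    intro J hJ
    have h1 : z * c J ∈ Ideal.span {z} := Ideal.mul_mem_right _ _ (Ideal.mem_span_singleton_self z)
    have h2 := (I ⊔ Ideal.span {z}).sub_mem (Ideal.mem_sup_right h1) (Ideal.mem_sup_left (hb J hJ))
    convert h2 using 1
    ring)
  have hex : ∀ J : Finset (Fin r), ∃ e : A,
      J.card < n → b J - cochainD y g J - z * e ∈ I := by
    intro J
    by_cases hJ : J.card < n
    · obtain ⟨u, hu, v, hv, huv⟩ := Submodule.mem_sup.1 (hg J hJ)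
      obtain ⟨e, rfl⟩ := Ideal.mem_span_singleton'.1 hv
      refine ⟨e, fun _ => ?_⟩
      rw [← huv, mul_comm z e, add_sub_cancel_right]
      exact hu
    · exact ⟨0, fun h => absurd h hJ⟩
  choose e he using hex
  refine ⟨e, fun J hJ => hz _ ?_⟩
  have h1 : cochainD y (fun K => b K - cochainD y g K - z * e K) J ∈ I :=
    cochainD_mem y fun K hK => he K (by omega)
  rw [cochainD_sub (b := fun K => b K - cochainD y g K), cochainD_sub, cochainD_cochainD,
    cochainD_mul_left, sub_zero] at h1
  convert I.add_mem (hb J (by omega)) h1 using 1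
  ring

/-- Rescaling the sequence by units does not change the range of vanishing. -/
theorem KoszulVanish.units_mul (h : KoszulVanish y I n) (u : Fin r → Aˣ) :
    KoszulVanish (fun j => (u j : A) * y j) I n := by
  -- Scaling the coordinate at `K` by `∏ k ∈ K, u k` is an isomorphism between the two complexes.
  have key : ∀ (c : Finset (Fin r) → A) (J : Finset (Fin r)),
      cochainD (fun j => (u j : A) * y j) (fun K => (∏ k ∈ K, (u k : A)) * c K) J =
        (∏ k ∈ J, (u k : A)) * cochainD y c J := by
    intro c J
    simp only [cochainD, Finset.mul_sum]
    refine Finset.sum_congr rfl fun j hj => ?_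
    rw [← Finset.mul_prod_erase J _ hj]
    ring
  have hu : ∀ J : Finset (Fin r), (∏ k ∈ J, (u k : A)) * (∏ k ∈ J, ((u k)⁻¹ : Aˣ) : Aˣ) = 1 := by
    intro J
    rw [← Units.coe_prod, ← Units.val_mul, ← Finset.prod_mul_distrib]
    simp
  have hcc : ∀ (c : Finset (Fin r) → A) (K : Finset (Fin r)),
      (∏ k ∈ K, (u k : A)) * ((∏ k ∈ K, ((u k)⁻¹ : Aˣ) : Aˣ) * c K) = c K := fun c K => by
    rw [← mul_assoc, hu, one_mul]
  intro c hc
  obtain ⟨b, hb⟩ := h (fun K => (∏ k ∈ K, ((u k)⁻¹ : Aˣ) : Aˣ) * c K) (by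
    intro J hJ
    have h1 := key (fun K => (∏ k ∈ K, ((u k)⁻¹ : Aˣ) : Aˣ) * c K) J
    simp only [hcc] at h1
    have h2 := I.mul_mem_left ((∏ k ∈ J, ((u k)⁻¹ : Aˣ) : Aˣ) : A) (hc J hJ)
    rw [h1, ← mul_assoc, mul_comm _ (∏ k ∈ J, (u k : A)), hu, one_mul] at h2
    exact h2)
  refine ⟨fun K => (∏ k ∈ K, (u k : A)) * b K, fun J hJ => ?_⟩
  rw [key]
  have h1 := I.mul_mem_left (∏ k ∈ J, (u k : A)) (hb J hJ)
  rwa [mul_sub, hcc] at h1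

end KoszulCoordinates

end NonNoethCM

namespace NonNoethCM

/-! ### Koszul grade of a sequence in terms of coordinates -/

section KoszulGrade

variable {A : Type*} [CommRing A] {r : ℕ}

/-- The linear form on Koszul chains of degree `i` with the coordinates `c`. -/
noncomputable def cochainHom (i : ℕ) (c : Finset (Fin r) → A) : KoszulChain A r i →ₗ[A] A :=
  ∑ I : Subsets r i, c I.1 • LinearMap.proj I

theorem cochainHom_apply (i : ℕ) (c : Finset (Fin r) → A) (v : KoszulChain A r i) :
    cochainHom i c v = ∑ I : Subsets r i, c I.1 * v I := by
  simp [cochainHom]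

theorem cochainHom_single (i : ℕ) (c : Finset (Fin r) → A) (I : Subsets r i) :
    cochainHom i c (Pi.single I 1) = c I.1 := by
  classical
  rw [cochainHom_apply, Finset.sum_eq_single I]
  · simp
  · intro K _ hK
    simp [hK]
  · simp

theorem cochainHom_eq_iff (i : ℕ) (b c : Finset (Fin r) → A) :
    cochainHom i b = cochainHom i c ↔ ∀ J : Finset (Fin r), J.card = i → b J = c J := by
  constructor
  · intro h J hJ
    rw [← cochainHom_single i b ⟨J, hJ⟩, h, cochainHom_single]
  · intro h
    refine LinearMap.ext fun v => ?_
    rw [cochainHom_apply, cochainHom_apply]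
    exact Finset.sum_congr rfl fun I _ => by rw [h I.1 I.2]

theorem exists_cochainHom_eq (i : ℕ) (f : KoszulChain A r i →ₗ[A] A) :
    ∃ c : Finset (Fin r) → A, (∀ J, J.card ≠ i → c J = 0) ∧ cochainHom i c = f := by
  refine ⟨fun J => if h : J.card = i then f (Pi.single ⟨J, h⟩ 1) else 0, fun J hJ => dif_neg hJ, ?_⟩
  refine LinearMap.pi_ext' fun I => LinearMap.ext_ring ?_
  simp only [LinearMap.comp_apply, LinearMap.coe_single]
  rw [cochainHom_single, dif_pos I.2]

/-- Adding `j ∉ J` to `J` against removing `j ∈ K` from `K`. -/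
def subsetsInsertEquiv (r i : ℕ) :
    (Σ J : Subsets r i, {j : Fin r // j ∉ J.1}) ≃ (Σ K : Subsets r (i + 1), {j : Fin r // j ∈ K.1})
    where
  toFun p := ⟨p.1.insert p.2, p.2.1, Finset.mem_insert_self _ _⟩
  invFun p := ⟨p.1.erase p.2, p.2.1, Finset.notMem_erase _ _⟩
  left_inv := by
    rintro ⟨⟨J, hJ⟩, j, hj⟩
    exact Sigma.subtype_ext (Subtype.ext (Finset.erase_insert hj)) rfl
  right_inv := by
    rintro ⟨⟨J, hJ⟩, j, hj⟩
    exact Sigma.subtype_ext (Subtype.ext (Finset.insert_erase hj)) rfl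

/-- This identifies `cochainD` as the transpose of `koszulD`: both sides sum over pairs of a set and
an index, matched by `subsetsInsertEquiv`, and inserting `j` does not change the position of `j`. -/
theorem cochainHom_comp_koszulD (y : Fin r → A) (i : ℕ) (c : Finset (Fin r) → A) :
    cochainHom i c ∘ₗ koszulD y i = cochainHom (i + 1) (cochainD y c) := by
  refine LinearMap.ext fun v => ?_
  rw [LinearMap.comp_apply, cochainHom_apply, cochainHom_apply]
  have h1 : ∀ J : Subsets r i, c J.1 * koszulD y i v J =
      ∑ j : {j : Fin r // j ∉ J.1}, c J.1 * ((-1) ^ position J.1 j.1 * y j.1 * v (J.insert j)) :=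
    fun J => by
      rw [← Finset.mul_sum]
      rfl
  have h2 : ∀ K : Subsets r (i + 1), cochainD y c K.1 * v K =
      ∑ j : {j : Fin r // j ∈ K.1}, (-1) ^ position K.1 j.1 * y j.1 * c (K.1.erase j.1) * v K := by
    intro K
    rw [cochainD, Finset.sum_mul,
      ← Finset.sum_coe_sort K.1 fun j => (-1) ^ position K.1 j * y j * c (K.1.erase j) * v K]
  rw [Finset.sum_congr rfl fun J _ => h1 J, Finset.sum_congr rfl fun K _ => h2 K,
    ← Fintype.sum_sigma', ← Fintype.sum_sigma']
  refine Fintype.sum_equiv (subsetsInsertEquiv r i) _ _ ?_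
  rintro ⟨⟨J, hJ⟩, j, hj⟩
  change c J * ((-1) ^ position J j * y j * v (Subsets.insert ⟨J, hJ⟩ ⟨j, hj⟩)) =
    (-1) ^ position (insert j J) j * y j * c ((insert j J).erase j) *
      v (Subsets.insert ⟨J, hJ⟩ ⟨j, hj⟩)
  have hj' : j ∉ J := hj
  rw [Finset.erase_insert hj', position_insert_of_not_lt hj' (lt_irrefl j)]
  ring

theorem subsingleton_koszulCohomology_iff (y : Fin r → A) (i : ℕ) :
    Subsingleton (KoszulCohomology y A i) ↔ ∀ c : Finset (Fin r) → A,
      (∀ J, J.card = i + 1 → cochainD y c J = 0) →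
        ∃ b : Finset (Fin r) → A, ∀ J, J.card = i → c J = cochainD y b J := by
  have hco : ∀ c : Finset (Fin r) → A, cochainHom i c ∈ koszulCocycles y A i ↔
      ∀ J, J.card = i + 1 → cochainD y c J = 0 := by
    intro c
    have h0 : cochainHom (i + 1) (fun _ : Finset (Fin r) => (0 : A)) = 0 := by
      refine LinearMap.ext fun v => ?_
      simp [cochainHom_apply]
    rw [koszulCocycles, LinearMap.mem_ker, LinearMap.lcomp_apply', cochainHom_comp_koszulD, ← h0,
      cochainHom_eq_iff]
  have hcb : ∀ c : Finset (Fin r) → A, cochainHom i c ∈ koszulCoboundaries y A i ↔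
      ∃ b : Finset (Fin r) → A, ∀ J, J.card = i → c J = cochainD y b J := by
    intro c
    cases i with
    | zero =>
      have h0 : cochainHom 0 (fun _ : Finset (Fin r) => (0 : A)) = 0 := by
        refine LinearMap.ext fun v => ?_
        simp [cochainHom_apply]
      rw [koszulCoboundaries, Submodule.mem_bot, ← h0, cochainHom_eq_iff]
      have h1 : ∀ (b : Finset (Fin r) → A) (J : Finset (Fin r)), J.card = 0 →
          cochainD y b J = 0 := by
        intro b J hJ
        rw [Finset.card_eq_zero.1 hJ]
        simp [cochainD]
      exact ⟨fun h => ⟨0, fun J hJ => by rw [h J hJ, h1 _ J hJ]⟩,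
        fun ⟨b, hb⟩ J hJ => by rw [hb J hJ, h1 _ J hJ]⟩
    | succ i =>
      rw [koszulCoboundaries, LinearMap.mem_range]
      constructor
      · rintro ⟨f, hf⟩
        obtain ⟨b, -, rfl⟩ := exists_cochainHom_eq i f
        rw [LinearMap.lcomp_apply', cochainHom_comp_koszulD, eq_comm, cochainHom_eq_iff] at hf
        exact ⟨b, hf⟩
      · rintro ⟨b, hb⟩
        refine ⟨cochainHom i b, ?_⟩
        rw [LinearMap.lcomp_apply', cochainHom_comp_koszulD, eq_comm, cochainHom_eq_iff]
        exact hb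
  refine Submodule.Quotient.subsingleton_iff.trans (Submodule.submoduleOf_eq_top.trans ?_)
  constructor
  · intro h c hc
    exact (hcb c).1 (h ((hco c).2 hc))
  · intro h f hf
    obtain ⟨c, -, rfl⟩ := exists_cochainHom_eq i f
    exact (hcb c).2 (h c ((hco c).1 hf))

theorem koszulVanish_bot_iff (y : Fin r → A) (n : ℕ) :
    KoszulVanish y ⊥ n ↔ ∀ i < n, Subsingleton (KoszulCohomology y A i) := by
  simp only [subsingleton_koszulCohomology_iff]
  constructor
  · intro h i hi c hc
    obtain ⟨b, hb⟩ := h (fun J => if J.card = i then c J else 0) (by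
      intro J _
      rw [Submodule.mem_bot]
      by_cases hJ : J.card = i + 1
      · rw [cochainD_congr (c := c) y fun K hK => if_pos (by omega)]
        exact hc J hJ
      · exact Finset.sum_eq_zero fun j hj => by
          simp only
          rw [if_neg (by have := Finset.card_erase_add_one hj; omega), mul_zero])
    refine ⟨b, fun J hJ => ?_⟩
    have := hb J (by omega)
    rw [if_pos hJ, Submodule.mem_bot, sub_eq_zero] at this
    exact this
  · intro h c hc
    have hex : ∀ i : ℕ, ∃ b : Finset (Fin r) → A, i < n → ∀ J, J.card = i → c J = cochainD y b J := by
      intro i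
      by_cases hi : i < n
      · obtain ⟨b, hb⟩ := h i hi c fun J hJ => by simpa using hc J (by omega)
        exact ⟨b, fun _ => hb⟩
      · exact ⟨0, fun h => absurd h hi⟩
    choose b hb using hex
    -- `b i` bounds `c` in degree `i`, so only its values in degree `i - 1` matter; hence the shift
    -- by one.
    refine ⟨fun K => b (K.card + 1) K, fun J hJ => ?_⟩
    rw [Submodule.mem_bot, sub_eq_zero, hb J.card hJ J rfl]
    exact cochainD_congr y fun K hK => by rw [hK]

theorem le_koszulGradeSeq_iff (y : Fin r → A) (n : ℕ) :
    (n : ℕ∞) ≤ koszulGradeSeq y A ↔ KoszulVanish y ⊥ n := by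
  rw [koszulVanish_bot_iff]
  simp only [koszulGradeSeq, le_iInf_iff, Nat.cast_le]
  refine forall_congr' fun i => ?_
  rw [← not_nontrivial_iff_subsingleton, ← not_le]
  tauto

end KoszulGrade

end NonNoethCM

namespace NonNoethCM

/-! ### Ideals generated by weakly regular sequences -/

section RegularIdeals

variable {A : Type*} [CommRing A]

/-- `z` is a nonzerodivisor modulo `I`. -/
def RegularMod (I : Ideal A) (z : A) : Prop := ∀ g, z * g ∈ I → g ∈ I

/-- The ideal `I` is generated by a weakly regular sequence of length `n`. -/
inductive IsRegIdeal : ℕ → Ideal A → Prop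
  | bot : IsRegIdeal 0 ⊥
  | step {n : ℕ} {I : Ideal A} (z : A) : IsRegIdeal n I → RegularMod I z →
      IsRegIdeal (n + 1) (I ⊔ Ideal.span {z})

variable {I J : Ideal A} {n m : ℕ}

theorem IsRegIdeal.exists_finset (h : IsRegIdeal n I) :
    ∃ s : Finset A, s.card ≤ n ∧ Ideal.span (s : Set A) = I := by
  classical
  induction h with
  | bot => exact ⟨∅, by simp⟩
  | step z _ _ ih =>
    obtain ⟨s, hs, rfl⟩ := ih
    refine ⟨insert z s, (Finset.card_insert_le z s).trans (by omega), ?_⟩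
    rw [Finset.coe_insert, Ideal.span_insert, sup_comm]

theorem IsRegIdeal.exists_le (h : IsRegIdeal n I) (hm : m ≤ n) : ∃ J ≤ I, IsRegIdeal m J := by
  induction h with
  | bot => exact ⟨⊥, le_rfl, by rw [Nat.le_zero.1 hm]; exact .bot⟩
  | @step k I z h hz ih =>
    rcases Nat.lt_or_ge k m with hk | hk
    · obtain rfl : m = k + 1 := by omega
      exact ⟨_, le_rfl, .step z h hz⟩
    · obtain ⟨J, hJ, hJm⟩ := ih hk
      exact ⟨J, hJ.trans le_sup_left, hJm⟩

/-- Each member of the regular sequence, removed from the last on, raises the range by one. For `k =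
0` the vanishing hypothesis is vacuous, which bounds the grade below by the length of a regular
sequence. -/
theorem IsRegIdeal.koszulVanish_bot {r : ℕ} {y : Fin r → A} {k : ℕ} (h : IsRegIdeal n I)
    (hI : I ≤ Ideal.span (Set.range y)) (hk : KoszulVanish y I k) : KoszulVanish y ⊥ (n + k) := by
  induction h generalizing k with
  | bot => rwa [zero_add]
  | @step n I z h hz ih =>
    rw [add_right_comm, add_assoc]
    exact ih (le_sup_left.trans hI) (hk.of_sup_span_singleton
      (hI (Ideal.mem_sup_right (Ideal.mem_span_singleton_self z))) hz)

theorem IsRegIdeal.koszulVanish {r : ℕ} {y : Fin r → A} {k : ℕ} (h : IsRegIdeal n I)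
    (hk : KoszulVanish y ⊥ (n + k)) : KoszulVanish y I k := by
  induction h generalizing k with
  | bot => rwa [zero_add] at hk
  | @step n I z h hz ih =>
    rw [add_right_comm, add_assoc] at hk
    exact (ih hk).sup_span_singleton hz

theorem RegularMod.notMem_of_mem_minimalPrimes {z : A} (hz : RegularMod I z) {Q : Ideal A}
    (hQ : Q ∈ I.minimalPrimes) : z ∉ Q := fun h => by
  obtain ⟨g, hg, hzg⟩ := Ideal.exists_mul_mem_of_mem_minimalPrimes hQ h
  exact hg (hz g hzg)

/-- An element regular modulo `I` avoids the minimal primes of `I`, so each member of the sequence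
forces a strictly larger prime. -/
theorem IsRegIdeal.le_height (h : IsRegIdeal n I) {P : Ideal A} [P.IsPrime] (hP : I ≤ P) :
    (n : ℕ∞) ≤ P.height := by
  induction h generalizing P with
  | bot => simp
  | @step n I z h hz ih =>
    obtain ⟨Q, hQ, hQP⟩ := Ideal.exists_minimalPrimes_le (le_sup_left.trans hP)
    have := hQ.isPrime
    have hlt : Q < P := lt_of_le_of_ne hQP fun he => hz.notMem_of_mem_minimalPrimes hQ
      (he ▸ hP (Ideal.mem_sup_right (Ideal.mem_span_singleton_self z)))
    have h1 := Ideal.height_add_one_le_of_lt_of_isPrime hlt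
    refine le_trans ?_ h1
    push_cast
    gcongr
    exact ih hQ.le

theorem IsRegIdeal.le_height_of_le (h : IsRegIdeal n I) (hJ : I ≤ J) : (n : ℕ∞) ≤ J.height := by
  rw [Ideal.height_eq_inf_minimalPrimes]
  refine le_iInf₂ fun P hP => ?_
  have := hP.isPrime
  exact h.le_height (hJ.trans hP.le)

end RegularIdeals

/-! ### Ring homomorphisms compatible with colon ideals -/

section Colon

variable {S A B : Type*} [CommRing S] [CommRing A] [CommRing B]

/-- Extension of ideals along `φ` commutes with the formation of `(I : g)`, as it does for flat
homomorphisms. -/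
def PreservesColon (φ : S →+* A) : Prop :=
  ∀ (I : Ideal S) (g : S) (s : A), φ g * s ∈ I.map φ → s ∈ (I.colon {g}).map φ

theorem PreservesColon.comp {φ : S →+* A} {ψ : A →+* B} (hψ : PreservesColon ψ)
    (hφ : PreservesColon φ) : PreservesColon (ψ.comp φ) := by
  intro I g s hs
  rw [← Ideal.map_map] at hs ⊢
  refine Ideal.map_mono (fun t ht => ?_) (hψ _ _ _ hs)
  rw [Submodule.mem_colon_singleton, smul_eq_mul, mul_comm] at ht
  exact hφ _ _ _ ht

theorem preservesColon_of_isLocalization (M : Submonoid A) [Algebra A B] [IsLocalization M B] :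
    PreservesColon (algebraMap A B) := by
  intro I g s hs
  obtain ⟨⟨a, t⟩, rfl⟩ := IsLocalization.mk'_surjective M s
  rw [mul_comm, mul_comm, IsLocalization.mul_mk'_eq_mk'_of_mul,
    IsLocalization.mk'_mem_map_algebraMap_iff] at hs
  obtain ⟨u, hu, h⟩ := hs
  simp only
  rw [IsLocalization.mk'_mem_map_algebraMap_iff]
  refine ⟨u, hu, ?_⟩
  rw [Submodule.mem_colon_singleton, smul_eq_mul]
  convert h using 1
  ring

theorem PreservesColon.regularMod_map {φ : S →+* A} (hφ : PreservesColon φ) {I : Ideal S} {z : S}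
    (hz : RegularMod I z) : RegularMod (I.map φ) (φ z) := by
  intro g hg
  refine Ideal.map_mono (fun t ht => ?_) (hφ _ _ _ hg)
  rw [Submodule.mem_colon_singleton, smul_eq_mul, mul_comm] at ht
  exact hz t ht

theorem IsRegIdeal.map {φ : S →+* A} (hφ : PreservesColon φ) {n : ℕ} {I : Ideal S}
    (h : IsRegIdeal n I) : IsRegIdeal n (I.map φ) := by
  induction h with
  | bot => rw [Ideal.map_bot]; exact .bot
  | step z _ hz ih =>
    rw [Ideal.map_sup, Ideal.map_span, Set.image_singleton]
    exact .step _ ih (hφ.regularMod_map hz)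

theorem notMem_of_isPrime_colon {I Q : Ideal A} [Q.IsPrime] {g : A} (hQ : Q = I.colon {g}) :
    g ∉ I := fun hg => Ideal.IsPrime.ne_top ‹Q.IsPrime› <| by
  rw [hQ, Ideal.eq_top_iff_one, Submodule.mem_colon_singleton, one_smul]
  exact hg

end Colon

/-! ### Noetherian rings -/

section Noetherian

variable {S : Type*} [CommRing S] [IsNoetherianRing S]

/-- The associated primes of `S ⧸ I`. -/
theorem exists_finite_associated (I : Ideal S) :
    ∃ T : Set (Ideal S), T.Finite ∧ (∀ Q ∈ T, Q.IsPrime ∧ ∃ g, Q = I.colon {g}) ∧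
      ∀ g ∉ I, ∃ Q ∈ T, I.colon {g} ≤ Q := by
  have hcol : ∀ g : S, (⊥ : Submodule S (S ⧸ I)).colon {Ideal.Quotient.mk I g} = I.colon {g} := by
    intro g
    ext s
    rw [Submodule.mem_colon_singleton, Submodule.mem_colon_singleton, Submodule.mem_bot,
      ← Ideal.Quotient.eq_zero_iff_mem]
    rfl
  refine ⟨associatedPrimes S (S ⧸ I), associatedPrimes.finite S (S ⧸ I), fun Q hQ => ?_,
    fun g hg => ?_⟩
  · obtain ⟨hp, x, hx⟩ := isAssociatedPrime_iff.1 hQ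
    obtain ⟨g, rfl⟩ := Ideal.Quotient.mk_surjective x
    exact ⟨hp, g, by rw [hx, hcol]⟩
  · obtain ⟨Q, hQ, hle⟩ := exists_le_isAssociatedPrime_of_isNoetherianRing S
      (Ideal.Quotient.mk I g) (fun h => hg (Ideal.Quotient.eq_zero_iff_mem.1 h))
    exact ⟨Q, hQ, by rwa [hcol] at hle⟩

/-- The zero divisors modulo `I` lie in finitely many associated primes; prime avoidance applies. -/
theorem exists_regularMod_or_le_associated (I a : Ideal S) :
    (∃ z ∈ a, RegularMod I z) ∨ ∃ Q : Ideal S, Q.IsPrime ∧ a ≤ Q ∧ ∃ g, Q = I.colon {g} := by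
  obtain ⟨T, hT, hTp, hTu⟩ := exists_finite_associated I
  by_cases h : (a : Set S) ⊆ ⋃ Q ∈ T, (Q : Set S)
  · right
    obtain ⟨Q, hQ, hle⟩ := (Ideal.subset_union_prime_finite (f := id) hT ⊤ ⊤
      fun Q hQ _ _ => (hTp Q hQ).1).1 h
    exact ⟨Q, (hTp Q hQ).1, hle, (hTp Q hQ).2⟩
  · left
    obtain ⟨z, hz, hzT⟩ := Set.not_subset.1 h
    refine ⟨z, hz, fun g hg => ?_⟩
    by_contra hgI
    obtain ⟨Q, hQ, hle⟩ := hTu g hgI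
    exact hzT (Set.mem_biUnion hQ (hle (by rwa [Submodule.mem_colon_singleton])))

theorem KoszulVanish.exists_regularMod {r n : ℕ} {y : Fin r → S} {I : Ideal S}
    (h : KoszulVanish y I (n + 1)) : ∃ z ∈ Ideal.span (Set.range y), RegularMod I z := by
  refine (exists_regularMod_or_le_associated I _).resolve_right ?_
  rintro ⟨Q, hQp, hle, g, hQ⟩
  refine notMem_of_isPrime_colon hQ ((h.mono (by omega : 1 ≤ n + 1)).mem_of_one fun j => ?_)
  have := hle (Ideal.subset_span (Set.mem_range_self j))
  rwa [hQ, Submodule.mem_colon_singleton] at this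

theorem KoszulVanish.exists_isRegIdeal {A : Type*} [CommRing A] {φ : S →+* A}
    (hφ : PreservesColon φ) {r : ℕ} {y : Fin r → S} {n m : ℕ} {I : Ideal S}
    (hI : IsRegIdeal m (I.map φ)) (h : KoszulVanish (fun j => φ (y j)) (I.map φ) n) :
    ∃ J ≤ I.map φ ⊔ (Ideal.span (Set.range y)).map φ, IsRegIdeal (m + n) J := by
  induction n generalizing m I with
  | zero => exact ⟨_, le_sup_left, hI⟩
  | succ n ih =>
    -- The regular element is sought in `S` modulo the contraction of `I.map φ`, which may exceed
    -- `I` but has the same extension.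
    have hmap : ((I.map φ).comap φ).map φ = I.map φ :=
      le_antisymm Ideal.map_comap_le (Ideal.map_mono Ideal.le_comap_map)
    obtain ⟨z, hz, hzr⟩ : ∃ z ∈ Ideal.span (Set.range y), RegularMod ((I.map φ).comap φ) z := by
      refine (exists_regularMod_or_le_associated _ _).resolve_right ?_
      rintro ⟨Q, hQp, hle, g, hQ⟩
      refine notMem_of_isPrime_colon hQ
        ((h.mono (by omega : 1 ≤ n + 1)).mem_of_one fun j => ?_)
      have := hle (Ideal.subset_span (Set.mem_range_self j))
      rw [hQ, Submodule.mem_colon_singleton, smul_eq_mul, Ideal.mem_comap, map_mul] at this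
      exact this
    have hzA := hφ.regularMod_map hzr
    rw [hmap] at hzA
    have hsup : (I ⊔ Ideal.span {z}).map φ = I.map φ ⊔ Ideal.span {φ z} := by
      rw [Ideal.map_sup, Ideal.map_span, Set.image_singleton]
    obtain ⟨J, hJ, hJr⟩ := ih (I := I ⊔ Ideal.span {z}) (m := m + 1)
      (by rw [hsup]; exact .step _ hI hzA) (by rw [hsup]; exact h.sup_span_singleton hzA)
    refine ⟨J, hJ.trans (sup_le ?_ le_sup_right), by rwa [add_assoc, add_comm 1] at hJr⟩
    rw [hsup]
    refine sup_le le_sup_left (le_sup_of_le_right ?_)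
    rw [Ideal.span_singleton_le_iff_mem]
    exact Ideal.mem_map_of_mem φ hz

/-- If the Koszul cohomology on `S ⧸ I` of generators of the maximal ideal vanishes below `n`, then
the associated primes of `S ⧸ I` have dimension at least `n`. -/
theorem KoszulVanish.height_add_le [IsLocalRing S] {r : ℕ} {y : Fin r → S}
    (hy : Ideal.span (Set.range y) = IsLocalRing.maximalIdeal S) {n : ℕ} {I Q : Ideal S}
    [hQp : Q.IsPrime] {g : S} (hQ : Q = I.colon {g}) (h : KoszulVanish y I n) :
    Q.height + n ≤ (IsLocalRing.maximalIdeal S).height := by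
  induction n generalizing I Q g with
  | zero =>
    simpa using Ideal.height_mono (IsLocalRing.le_maximalIdeal hQp.ne_top)
  | succ n ih =>
    obtain ⟨z, hz, hzr⟩ := h.exists_regularMod
    rw [hy] at hz
    -- Otherwise regularity of `z` gives `(I : Q) ⊆ I + z (I : Q)`, and Nakayama gives `(I : Q) ⊆
    -- I`, although `g` lies in `(I : Q)` and not in `I`.
    have hN : ¬ I.colon (Q : Set S) ≤ I ⊔ Ideal.span {z} := by
      intro hle
      have hNI : I.colon (Q : Set S) ≤ I := by
        refine Submodule.le_of_le_smul_of_le_jacobson_bot (I := Ideal.span {z})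
          (IsNoetherian.noetherian _) ?_ ?_
        · rw [IsLocalRing.jacobson_eq_maximalIdeal ⊥ bot_ne_top,
            Ideal.span_singleton_le_iff_mem]
          exact hz
        · intro s hs
          obtain ⟨u, hu, v, hv, rfl⟩ := Submodule.mem_sup.1 (hle hs)
          obtain ⟨t, rfl⟩ := Ideal.mem_span_singleton'.1 hv
          refine Submodule.add_mem_sup hu ?_
          rw [mul_comm, smul_eq_mul]
          refine Ideal.mul_mem_mul (Ideal.mem_span_singleton_self z) ?_
          rw [Submodule.mem_colon] at hs ⊢
          intro q hq
          refine hzr _ ?_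
          have h1 := I.sub_mem (hs q hq) (I.mul_mem_right q hu)
          rw [smul_eq_mul] at h1 ⊢
          convert h1 using 1
          ring
      refine notMem_of_isPrime_colon hQ (hNI ?_)
      rw [Submodule.mem_colon]
      intro q hq
      rw [hQ, SetLike.mem_coe, Submodule.mem_colon_singleton, smul_eq_mul, mul_comm] at hq
      exact hq
    -- An associated prime `Q'` of `I ⊔ (z)` above the annihilator of `s` contains `Q` and `z`,
    -- while `z ∉ Q`; induction applies to `Q'`.
    obtain ⟨s, hs, hsI⟩ := Set.not_subset.1 hN
    obtain ⟨T, -, hTp, hTu⟩ := exists_finite_associated (I ⊔ Ideal.span {z})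
    obtain ⟨Q', hQ', hle⟩ := hTu s hsI
    obtain ⟨hQ'p, g', hg'⟩ := hTp Q' hQ'
    have hzQ : z ∉ Q := by
      intro hzQ
      rw [hQ, Submodule.mem_colon_singleton] at hzQ
      exact notMem_of_isPrime_colon hQ (hzr _ hzQ)
    have hlt : Q < Q' := by
      refine lt_of_le_of_ne (fun q hq => hle ?_) fun he => hzQ (he ▸ hle ?_)
      · rw [Submodule.mem_colon_singleton]
        have := (Submodule.mem_colon.1 hs) q hq
        rw [smul_eq_mul, mul_comm] at this
        exact Ideal.mem_sup_left this
      · rw [Submodule.mem_colon_singleton]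
        exact Ideal.mem_sup_right (Ideal.mul_mem_right _ _ (Ideal.mem_span_singleton_self z))
    have h1 := ih hg' (h.sup_span_singleton hzr)
    have h2 := Ideal.height_add_one_le_of_lt_of_isPrime hlt
    calc Q.height + (n + 1 : ℕ) = Q.height + 1 + n := by push_cast; ring
      _ ≤ Q'.height + n := by gcongr
      _ ≤ _ := h1

end Noetherian

end NonNoethCM

namespace NonNoethCM

/-! ### Noetherian Cohen-Macaulay rings -/

section NoetherianCM

open RingTheory.Sequence

theorem isSMulRegular_quotient_iff {A : Type*} [CommRing A] (I : Ideal A) (z : A) :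
    IsSMulRegular (A ⧸ (I • ⊤ : Submodule A A)) z ↔ RegularMod I z := by
  rw [isSMulRegular_quotient_iff_mem_of_smul_mem]
  simp [RegularMod]

theorem isRegIdeal_ofList {A : Type*} [CommRing A] {l : List A} (h : IsWeaklyRegular A l) :
    IsRegIdeal l.length (Ideal.ofList l) := by
  induction l using List.reverseRecOn with
  | nil => simpa using IsRegIdeal.bot
  | append_singleton l z ih =>
    rw [isWeaklyRegular_append_iff, isWeaklyRegular_singleton_iff, isSMulRegular_quotient_iff] at h
    rw [List.length_append, List.length_singleton, Ideal.ofList_append, Ideal.ofList_singleton]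
    exact .step z (ih h.1) h.2

/-- Every prime ideal contains weakly regular sequences of all lengths up to its height. -/
def IsGradeCM (S : Type*) [CommRing S] : Prop :=
  ∀ (P : Ideal S) [P.IsPrime] (n : ℕ), (n : ℕ∞) ≤ P.height → ∃ J ≤ P, IsRegIdeal n J

variable {S : Type*} [CommRing S]

/-- If a sequence of length `n` in `P` cannot be prolonged, then `P` lies in an associated prime `Q`
of `J`. At a maximal ideal of height `d` above `Q` the Koszul cohomology modulo `J` vanishes below
`d - n`, so `ht Q + (d - n) ≤ d`, against `ht P ≥ n + 1`. -/
theorem isGradeCM_of_isMaximal [IsNoetherianRing S]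
    (h : ∀ (m : Ideal S) [m.IsMaximal] (n : ℕ), m.height = n →
      ∃ J ≤ IsLocalRing.maximalIdeal (Localization.AtPrime m), IsRegIdeal n J) :
    IsGradeCM S := by
  intro P hP n hn
  induction n with
  | zero => exact ⟨⊥, bot_le, .bot⟩
  | succ n ih =>
    obtain ⟨J, hJP, hJ⟩ := ih (le_trans (by simp) hn)
    rcases exists_regularMod_or_le_associated J P with ⟨z, hz, hzr⟩ | ⟨Q, hQp, hPQ, g, hQ⟩
    · exact ⟨_, sup_le hJP ((Ideal.span_singleton_le_iff_mem _).2 hz), .step z hJ hzr⟩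
    exfalso
    obtain ⟨m, hm, hQm⟩ := Ideal.exists_le_maximal Q hQp.ne_top
    let B := Localization.AtPrime m
    let 𝔪 := IsLocalRing.maximalIdeal B
    have hcol : PreservesColon (algebraMap S B) := preservesColon_of_isLocalization m.primeCompl
    have hdisj : Disjoint (m.primeCompl : Set S) (Q : Set S) :=
      Set.disjoint_left.2 fun s hs hsQ => hs (hQm hsQ)
    have hQBp : (Q.map (algebraMap S B)).IsPrime :=
      IsLocalization.isPrime_of_isPrime_disjoint m.primeCompl B Q hQp hdisj
    have hQB : Q.map (algebraMap S B) = (J.map (algebraMap S B)).colon {algebraMap S B g} := by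
      refine le_antisymm (Ideal.map_le_iff_le_comap.2 fun s hs => ?_) fun s hs => ?_
      · rw [hQ, Submodule.mem_colon_singleton] at hs
        rw [Ideal.mem_comap, Submodule.mem_colon_singleton, smul_eq_mul, ← map_mul]
        exact Ideal.mem_map_of_mem _ hs
      · rw [Submodule.mem_colon_singleton, smul_eq_mul, mul_comm] at hs
        rw [hQ]
        exact hcol _ _ _ hs
    have hht : m.height = 𝔪.height := by
      rw [← IsLocalization.height_under m.primeCompl 𝔪,
        IsLocalization.AtPrime.under_maximalIdeal B m]
    obtain ⟨d, hd⟩ := ENat.ne_top_iff_exists.1 (Ideal.height_ne_top hm.ne_top)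
    obtain ⟨J', hJ', hJ'r⟩ := h m d hd.symm
    obtain ⟨r, y, hy⟩ := Submodule.fg_iff_exists_fin_generating_family.1
      (IsNoetherian.noetherian 𝔪)
    have hJB := hJ.map hcol
    have hnd : n ≤ d := by
      have h1 := hJB.le_height (P := 𝔪) (IsLocalRing.le_maximalIdeal fun htop =>
        hQBp.ne_top (top_le_iff.1 (htop ▸ Ideal.map_mono (hJP.trans hPQ))))
      rw [← hht, ← hd] at h1
      exact_mod_cast h1
    have hv : KoszulVanish y ⊥ (n + (d - n)) := by
      rw [Nat.add_sub_cancel' hnd, ← add_zero d]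
      exact hJ'r.koszulVanish_bot (hJ'.trans hy.ge) (koszulVanish_zero y J')
    have hbound := (hJB.koszulVanish hv).height_add_le hy hQB
    have hQht : Q.height = (Q.map (algebraMap S B)).height :=
      (IsLocalization.height_map_of_disjoint m.primeCompl Q hdisj).symm
    have h2 : ((n + 1 : ℕ) : ℕ∞) + (d - n : ℕ) ≤ d := by
      rw [hd, hht]
      refine le_trans ?_ hbound
      gcongr
      exact (hn.trans (Ideal.height_mono hPQ)).trans hQht.le
    have h3 : n + 1 + (d - n) ≤ d := by exact_mod_cast h2
    omega

theorem IsClassicalCM.isGradeCM [IsNoetherianRing S] (hS : IsClassicalCM S) : IsGradeCM S := by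
  refine isGradeCM_of_isMaximal fun m hm n hn => ?_
  cases n with
  | zero => exact ⟨⊥, bot_le, .bot⟩
  | succ n =>
    have h1 := hS m
    rw [IsLocalization.AtPrime.ringKrullDim_eq_height m, hn] at h1
    have h2 : depth (Localization.AtPrime m) = ((n + 1 : ℕ) : ℕ∞) := by exact_mod_cast h1
    have h3 : (n : ℕ∞) < depth (Localization.AtPrime m) := by
      rw [h2]
      exact_mod_cast Nat.lt_succ_self n
    simp only [depth, lt_iSup_iff, Nat.cast_lt] at h3
    obtain ⟨s, hs, hreg, hlen⟩ := h3
    obtain ⟨J, hJ, hJr⟩ := (isRegIdeal_ofList hreg.toIsWeaklyRegular).exists_le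
      (Nat.succ_le_of_lt hlen)
    exact ⟨J, hJ.trans (Ideal.span_le.2 hs), hJr⟩

theorem preservesColon_ringEquiv {S' : Type*} [CommRing S'] (e : S ≃+* S') :
    PreservesColon (e : S →+* S') := by
  intro I g s hs
  obtain ⟨t, rfl⟩ := e.surjective s
  rw [RingEquiv.coe_toRingHom, ← map_mul] at hs
  obtain ⟨u, hu, hue⟩ := (Ideal.mem_map_of_equiv e _).1 hs
  rw [e.injective hue] at hu
  refine Ideal.mem_map_of_mem (e : S →+* S') ?_
  rwa [Submodule.mem_colon_singleton, smul_eq_mul, mul_comm]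

theorem IsGradeCM.of_ringEquiv {S' : Type*} [CommRing S'] (hS : IsGradeCM S) (e : S ≃+* S') :
    IsGradeCM S' := by
  intro P hP n hn
  obtain ⟨J, hJ, hJr⟩ := hS (P.comap (e : S →+* S')) n (hn.trans (e.height_comap P).ge)
  exact ⟨J.map (e : S →+* S'), Ideal.map_le_iff_le_comap.2 hJ, hJr.map (preservesColon_ringEquiv e)⟩

theorem preservesColon_polynomialC : PreservesColon (Polynomial.C : S →+* Polynomial S) := by
  intro I g s hs
  rw [Ideal.mem_map_C_iff] at hs ⊢
  intro n
  have := hs n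
  rwa [Polynomial.coeff_C_mul, mul_comm, ← smul_eq_mul, ← Submodule.mem_colon_singleton] at this

/-- McCoy's theorem over `S ⧸ I`: a polynomial that is a zero divisor is killed by a nonzero
constant. -/
theorem exists_notMem_mul_coeff_mem {I : Ideal S} {f : Polynomial S}
    (hf : ¬ RegularMod (I.map Polynomial.C) f) : ∃ s ∉ I, ∀ n, f.coeff n * s ∈ I := by
  have key : ∀ g : Polynomial S, g ∈ I.map Polynomial.C ↔ g.map (Ideal.Quotient.mk I) = 0 := by
    intro g
    simp [Ideal.mem_map_C_iff, Polynomial.ext_iff, Ideal.Quotient.eq_zero_iff_mem]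
  simp only [RegularMod, not_forall] at hf
  obtain ⟨g, hfg, hg⟩ := hf
  rw [key] at hfg hg
  rw [Polynomial.map_mul] at hfg
  have hnd : f.map (Ideal.Quotient.mk I) ∉ nonZeroDivisors (Polynomial (S ⧸ I)) := fun h =>
    hg (h.1 _ hfg)
  obtain ⟨a, ha, haf⟩ := Polynomial.notMem_nonZeroDivisors_iff.1 hnd
  obtain ⟨s, rfl⟩ := Ideal.Quotient.mk_surjective a
  refine ⟨s, fun hs => ha (Ideal.Quotient.eq_zero_iff_mem.2 hs), fun n => ?_⟩
  have := congrArg (fun q => Polynomial.coeff q n) haf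
  simp only [Polynomial.coeff_smul, Polynomial.coeff_map, Polynomial.coeff_zero, smul_eq_mul,
    ← map_mul] at this
  rw [mul_comm]
  exact Ideal.Quotient.eq_zero_iff_mem.1 this

theorem IsGradeCM.polynomial [IsNoetherianRing S] (hS : IsGradeCM S) :
    IsGradeCM (Polynomial S) := by
  refine isGradeCM_of_isMaximal fun P hP n hn => ?_
  suffices h : ∃ J ≤ P, IsRegIdeal n J by
    obtain ⟨J, hJ, hJr⟩ := h
    refine ⟨J.map (algebraMap _ (Localization.AtPrime P)), ?_,
      hJr.map (preservesColon_of_isLocalization P.primeCompl)⟩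
    rw [← Localization.AtPrime.map_eq_maximalIdeal]
    exact Ideal.map_mono hJ
  let p : Ideal S := P.under S
  have hlies : P.LiesOver p := ⟨rfl⟩
  have hPp : P.height = p.height + 1 := Polynomial.height_eq_height_add_one p P
  have hptop : p.height ≠ ⊤ := Ideal.height_ne_top_of_isPrime
  obtain ⟨h, hh⟩ := ENat.ne_top_iff_exists.1 hptop
  have hnh : n = h + 1 := by
    rw [hn, ← hh] at hPp
    exact_mod_cast hPp
  subst hnh
  obtain ⟨J, hJp, hJ⟩ := hS p h hh.le
  have hJC := hJ.map preservesColon_polynomialC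
  have hJP : J.map Polynomial.C ≤ P := Ideal.map_le_iff_le_comap.2 hJp
  by_cases hex : ∃ f ∈ P, RegularMod (J.map Polynomial.C) f
  · obtain ⟨f, hf, hfr⟩ := hex
    exact ⟨_, sup_le hJP ((Ideal.span_singleton_le_iff_mem _).2 hf), .step f hJC hfr⟩
  exfalso
  push Not at hex
  obtain ⟨T, hT, hTp, hTu⟩ := exists_finite_associated J
  -- By McCoy, every element of `P` has all its coefficients in one associated prime of `J`. Prime
  -- avoidance and maximality then force `P = Q S[X]`.
  have hsub : (P : Set (Polynomial S)) ⊆ ⋃ Q ∈ T, (Q.map Polynomial.C : Ideal (Polynomial S)) := by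
    intro f hf
    obtain ⟨s, hs, hsf⟩ := exists_notMem_mul_coeff_mem (hex f hf)
    obtain ⟨Q, hQ, hle⟩ := hTu s hs
    refine Set.mem_biUnion hQ (Ideal.mem_map_C_iff.2 fun n => hle ?_)
    rw [Submodule.mem_colon_singleton]
    exact hsf n
  have hprime : ∀ Q ∈ T, (Q.map Polynomial.C : Ideal (Polynomial S)).IsPrime := fun Q hQ => by
    have := (hTp Q hQ).1
    infer_instance
  obtain ⟨Q, hQ, hle⟩ := (Ideal.subset_union_prime_finite hT ⊤ ⊤ fun Q hQ _ _ => hprime Q hQ).1 hsub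
  have hPQ := hP.eq_of_le (hprime Q hQ).ne_top hle
  have hpQ : p = Q := by
    ext s
    change Polynomial.C s ∈ P ↔ s ∈ Q
    rw [hPQ, Ideal.mem_map_C_iff]
    refine ⟨fun h => by simpa using h 0, fun h n => ?_⟩
    rw [Polynomial.coeff_C]
    split_ifs
    · exact h
    · exact Q.zero_mem
  -- Going down makes the height of `p S[X]` equal to that of `p`, against `ht P = ht p + 1`.
  have hgd := Ideal.height_eq_height_add_of_liesOver_of_hasGoingDown p P
  have hPm : P = p.map (algebraMap S (Polynomial S)) := by rw [hpQ]; exact hPQ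
  have hbot : P.map (Ideal.Quotient.mk (p.map (algebraMap S (Polynomial S)))) = ⊥ := by
    rw [← hPm, Ideal.map_quotient_self]
  have hnt : Nontrivial (Polynomial S ⧸ p.map (algebraMap S (Polynomial S))) := by
    rw [← hPm]
    exact Ideal.Quotient.nontrivial_iff.2 hP.ne_top
  rw [hbot, Ideal.height_bot, hPp, ← hh] at hgd
  have : h + 1 = h + 0 := by exact_mod_cast hgd
  omega

theorem IsGradeCM.mvPolynomial_fin [IsNoetherianRing S] (hS : IsGradeCM S) (k : ℕ) :
    IsGradeCM (MvPolynomial (Fin k) S) := by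
  induction k with
  | zero => exact hS.of_ringEquiv (MvPolynomial.isEmptyRingEquiv S (Fin 0)).symm
  | succ k ih => exact ih.polynomial.of_ringEquiv (MvPolynomial.finSuccEquiv S k).symm.toRingEquiv

/-- The associated primes of an ideal generated by a regular sequence are minimal. -/
theorem IsGradeCM.mem_minimalPrimes [IsNoetherianRing S] (hS : IsGradeCM S) {n : ℕ} {J P : Ideal S}
    (hJ : IsRegIdeal n J) [P.IsPrime] {g : S} (hP : P = J.colon {g}) : P ∈ J.minimalPrimes := by
  have hJP : J ≤ P := fun s hs => by
    rw [hP, Submodule.mem_colon_singleton]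
    exact J.mul_mem_right g hs
  refine Ideal.mem_minimalPrimes_of_height_le hJP (le_trans ?_ (hJ.le_height_of_le le_rfl))
  -- A regular sequence of length `n + 1` in `P` would leave vanishing in degree `0` modulo `J`, but
  -- `g` is a nonzero class killed by `P`.
  by_contra hlt
  obtain ⟨J', hJ', hJ'r⟩ := hS P (n + 1) (by
    push_cast
    exact Order.add_one_le_of_lt (not_le.1 hlt))
  obtain ⟨r, y, hy⟩ := Submodule.fg_iff_exists_fin_generating_family.1 (IsNoetherian.noetherian P)
  have hv : KoszulVanish y ⊥ (n + 1) := by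
    rw [← add_zero (n + 1)]
    exact hJ'r.koszulVanish_bot (hJ'.trans hy.ge) (koszulVanish_zero y J')
  refine notMem_of_isPrime_colon hP ((hJ.koszulVanish hv).mem_of_one fun j => ?_)
  have hj : y j ∈ P := hy ▸ Ideal.subset_span (Set.mem_range_self j)
  rwa [hP, Submodule.mem_colon_singleton] at hj

end NoetherianCM

end NonNoethCM

namespace NonNoethCM

/-! ### Polynomial-like extensions -/

section Extensions

variable {S A : Type*} [CommRing S] [CommRing A]

/-- The properties of the inclusion of a ring into a polynomial ring that are used below. -/
structure IsPolynomialLike (φ : S →+* A) : Prop where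
  preservesColon : PreservesColon φ
  comap_map : ∀ I : Ideal S, (I.map φ).comap φ = I
  isPrime_map : ∀ P : Ideal S, P.IsPrime → (P.map φ).IsPrime

theorem isPolynomialLike_mvPolynomialC (σ : Type*) :
    IsPolynomialLike (MvPolynomial.C : S →+* MvPolynomial σ S) where
  preservesColon := by
    intro I g s hs
    rw [MvPolynomial.mem_map_C_iff] at hs ⊢
    intro n
    have := hs n
    rwa [MvPolynomial.coeff_C_mul, mul_comm, ← smul_eq_mul,
      ← Submodule.mem_colon_singleton] at this
  comap_map := by
    classical
    intro I
    refine le_antisymm (fun s hs => ?_) Ideal.le_comap_map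
    rw [Ideal.mem_comap, MvPolynomial.mem_map_C_iff] at hs
    simpa using hs 0
  isPrime_map := by
    intro P hP
    rw [← Ideal.Quotient.isDomain_iff_prime]
    exact (MvPolynomial.quotientEquivQuotientMvPolynomial (σ := σ) P).symm.toMulEquiv.isDomain

theorem IsPolynomialLike.ringEquiv_comp {B : Type*} [CommRing B] {φ : S →+* A}
    (hφ : IsPolynomialLike φ) (e : A ≃+* B) : IsPolynomialLike ((e : A →+* B).comp φ) where
  preservesColon := (preservesColon_ringEquiv e).comp hφ.preservesColon
  comap_map I := by
    have h : ((I.map φ).map (e : A →+* B)).comap (e : A →+* B) = I.map φ :=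
      Ideal.comap_map_of_bijective _ e.bijective
    rw [← Ideal.map_map, ← Ideal.comap_comap, h, hφ.comap_map]
  isPrime_map P hP := by
    have := hφ.isPrime_map P hP
    rw [← Ideal.map_map]
    exact Ideal.map_isPrime_of_equiv e

variable {φ : S →+* A}

theorem IsPolynomialLike.comap_mem_minimalPrimes (hφ : IsPolynomialLike φ) {I : Ideal S}
    {p : Ideal A} (hp : p ∈ (I.map φ).minimalPrimes) : p.comap φ ∈ I.minimalPrimes := by
  have := hp.isPrime
  refine ⟨⟨inferInstance, Ideal.map_le_iff_le_comap.1 hp.le⟩, fun Q hQ hle => ?_⟩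
  have h1 := hp.2 ⟨hφ.isPrime_map Q hQ.1, Ideal.map_mono hQ.2⟩ (Ideal.map_le_iff_le_comap.2 hle)
  exact (Ideal.comap_mono h1).trans (hφ.comap_map Q).le

theorem IsPolynomialLike.map_comap_of_mem_minimalPrimes (hφ : IsPolynomialLike φ) {I : Ideal S}
    {p : Ideal A} (hp : p ∈ (I.map φ).minimalPrimes) : (p.comap φ).map φ = p := by
  have := hp.isPrime
  exact le_antisymm Ideal.map_comap_le (hp.2 ⟨hφ.isPrime_map _ inferInstance,
    Ideal.map_mono (Ideal.map_le_iff_le_comap.1 hp.le)⟩ Ideal.map_comap_le)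

theorem IsPolynomialLike.map_mem_minimalPrimes (hφ : IsPolynomialLike φ) {I Q : Ideal S}
    (hQ : Q ∈ I.minimalPrimes) : Q.map φ ∈ (I.map φ).minimalPrimes := by
  have := hQ.isPrime
  refine ⟨⟨hφ.isPrime_map Q inferInstance, Ideal.map_mono hQ.le⟩, fun q hq hle => ?_⟩
  have := hq.1
  have h1 : q.comap φ ≤ Q := (Ideal.comap_mono hle).trans (hφ.comap_map Q).le
  exact Ideal.map_le_iff_le_comap.2
    (hQ.2 ⟨inferInstance, Ideal.map_le_iff_le_comap.1 hq.2⟩ h1)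

theorem IsPolynomialLike.finite_minimalPrimes [IsNoetherianRing S] (hφ : IsPolynomialLike φ)
    (I : Ideal S) : (I.map φ).minimalPrimes.Finite := by
  refine ((Ideal.finite_minimalPrimes_of_isNoetherianRing S I).image (Ideal.map φ)).subset ?_
  intro p hp
  exact ⟨p.comap φ, hφ.comap_mem_minimalPrimes hp, hφ.map_comap_of_mem_minimalPrimes hp⟩

theorem IsPolynomialLike.colon_map (hφ : IsPolynomialLike φ) (I : Ideal S) (g : S) :
    (I.map φ).colon {φ g} = (I.colon {g}).map φ := by
  refine le_antisymm (fun s hs => ?_) (Ideal.map_le_iff_le_comap.2 fun s hs => ?_)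
  · rw [Submodule.mem_colon_singleton, smul_eq_mul, mul_comm] at hs
    exact hφ.preservesColon _ _ _ hs
  · rw [Submodule.mem_colon_singleton] at hs
    rw [Ideal.mem_comap, Submodule.mem_colon_singleton, smul_eq_mul, ← map_mul]
    exact Ideal.mem_map_of_mem φ hs

end Extensions

/-! ### Unions of Noetherian Cohen-Macaulay rings -/

section Locally

universe u

/-- Every finite subset of `A` lies in a Noetherian Cohen-Macaulay ring over which `A` is
polynomial-like. -/
def IsLocallyCM (A : Type u) [CommRing A] : Prop :=
  ∀ F : Finset A, ∃ (S : Type u) (_ : CommRing S) (φ : S →+* A), IsNoetherianRing S ∧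
    IsGradeCM S ∧ IsPolynomialLike φ ∧ ∀ f ∈ F, f ∈ Set.range φ

theorem isLocallyCM_mvPolynomial {R : Type u} [CommRing R] [IsNoetherianRing R]
    (hR : IsGradeCM R) : IsLocallyCM (MvPolynomial ℕ R) := by
  classical
  intro F
  obtain ⟨k, hk⟩ : ∃ k : ℕ, ∀ f ∈ F, ∀ i ∈ f.vars, i < k := by
    refine ⟨(F.biUnion MvPolynomial.vars).sup id + 1, fun f hf i hi => Nat.lt_succ_of_le ?_⟩
    exact Finset.le_sup (f := id) (Finset.mem_biUnion.2 ⟨f, hf, hi⟩)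
  -- The `k` inner variables become the first `k` variables and the outer ones are shifted behind
  -- them.
  let e : MvPolynomial ℕ (MvPolynomial (Fin k) R) ≃ₐ[R] MvPolynomial ℕ R :=
    (MvPolynomial.sumAlgEquiv R ℕ (Fin k)).symm.trans
      (MvPolynomial.renameEquiv R ((Equiv.sumComm ℕ (Fin k)).trans (finSumNatEquiv k)))
  have he : ∀ p : MvPolynomial (Fin k) R,
      e (MvPolynomial.C p) = MvPolynomial.rename (Fin.val : Fin k → ℕ) p := by
    have h : (e.toAlgHom.comp (IsScalarTower.toAlgHom R (MvPolynomial (Fin k) R)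
        (MvPolynomial ℕ (MvPolynomial (Fin k) R)))) =
          MvPolynomial.rename (Fin.val : Fin k → ℕ) := by
      ext i
      simp [e, MvPolynomial.algebraMap_eq]
    intro p
    exact DFunLike.congr_fun h p
  refine ⟨MvPolynomial (Fin k) R, inferInstance,
    (RingHomClass.toRingHom e.toRingEquiv).comp MvPolynomial.C,
    inferInstance, hR.mvPolynomial_fin k,
    (isPolynomialLike_mvPolynomialC ℕ).ringEquiv_comp e.toRingEquiv, fun f hf => ?_⟩
  obtain ⟨q, hq⟩ := MvPolynomial.exists_rename_eq_of_vars_subset_range f (Fin.val : Fin k → ℕ)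
    Fin.val_injective fun i hi => ⟨⟨i, hk f hf i hi⟩, rfl⟩
  exact ⟨q, (he q).trans hq⟩

variable {A : Type u} [CommRing A]

/-- Regularity descends because contraction undoes extension. `F` is chosen before `S`, so further
elements can be required to lie in `S`. -/
theorem IsRegIdeal.exists_descent {n : ℕ} {J : Ideal A} (h : IsRegIdeal n J) :
    ∃ F : Finset A, ∀ (S : Type u) [CommRing S] (φ : S →+* A), IsPolynomialLike φ →
      (∀ f ∈ F, f ∈ Set.range φ) → ∃ J₀ : Ideal S, IsRegIdeal n J₀ ∧ J₀.map φ = J := by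
  classical
  induction h with
  | bot => exact ⟨∅, fun S _ φ _ _ => ⟨⊥, .bot, Ideal.map_bot⟩⟩
  | @step n J z _ hz ih =>
    obtain ⟨F, hF⟩ := ih
    refine ⟨insert z F, fun S _ φ hφ hr => ?_⟩
    obtain ⟨J₀, hJ₀, rfl⟩ := hF S φ hφ fun f hf => hr f (Finset.mem_insert_of_mem hf)
    obtain ⟨w, rfl⟩ := hr z (Finset.mem_insert_self z F)
    refine ⟨J₀ ⊔ Ideal.span {w}, .step w hJ₀ fun g hg => ?_, ?_⟩
    · rw [← hφ.comap_map J₀]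
      exact hz _ (by rw [← map_mul]; exact Ideal.mem_map_of_mem φ hg)
    · rw [Ideal.map_sup, Ideal.map_span, Set.image_singleton]

/-- One element witnesses each strict inclusion in a chain of primes below `p`; once these elements
come from `S`, the contracted chain stays strict. -/
theorem exists_finset_le_height_comap {p : Ideal A} [p.IsPrime] {n : ℕ} (h : (n : ℕ∞) ≤ p.height) :
    ∃ F : Finset A, ∀ (S : Type u) [CommRing S] (φ : S →+* A),
      (∀ f ∈ F, f ∈ Set.range φ) → (n : ℕ∞) ≤ (p.comap φ).height := by
  classical
  induction n generalizing p with
  | zero => exact ⟨∅, fun S _ φ _ => by simp⟩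
  | succ n ih =>
    obtain ⟨q, hq, hqp, hn⟩ : ∃ q : Ideal A, q.IsPrime ∧ q < p ∧ (n : ℕ∞) ≤ q.height := by
      by_contra hcon
      push Not at hcon
      have h1 : (n + 1 : ℕ) ≤ (n : ℕ∞) := h.trans (Ideal.height_le_iff.2 fun q hq hlt =>
        hcon q hq hlt)
      have : n + 1 ≤ n := by exact_mod_cast h1
      omega
    obtain ⟨F, hF⟩ := ih hn
    obtain ⟨z, hzp, hzq⟩ := Set.not_subset.1 hqp.not_ge
    refine ⟨insert z F, fun S _ φ hr => ?_⟩
    obtain ⟨w, rfl⟩ := hr z (Finset.mem_insert_self z F)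
    have h1 := hF S φ fun f hf => hr f (Finset.mem_insert_of_mem hf)
    have hlt : q.comap φ < p.comap φ :=
      lt_of_le_of_ne (Ideal.comap_mono hqp.le) fun he => hzq (by
        have : w ∈ p.comap φ := hzp
        rwa [← he] at this)
    have h2 := Ideal.height_add_one_le_of_lt_of_isPrime hlt
    refine le_trans ?_ h2
    push_cast
    gcongr

/-- Krull's height theorem. -/
theorem IsLocallyCM.height_le (hA : IsLocallyCM A) {s : Finset A} {p : Ideal A}
    (hp : p ∈ (Ideal.span (s : Set A)).minimalPrimes) : p.height ≤ s.card := by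
  classical
  have := hp.isPrime
  by_contra hlt
  obtain ⟨F, hF⟩ := exists_finset_le_height_comap (p := p) (n := s.card + 1) (by
    push_cast
    exact Order.add_one_le_of_lt (not_le.1 hlt))
  obtain ⟨S, _, φ, _, -, hφ, hr⟩ := hA (F ∪ s)
  have h1 := hF S φ fun f hf => hr f (Finset.mem_union_left _ hf)
  have hsub : (s : Set A) ⊆ Set.range φ := fun f hf => hr f (Finset.mem_union_right _ hf)
  -- One preimage per generator, so that Krull's theorem in `S` gives the same bound.
  obtain ⟨t, htcard, ht⟩ : ∃ t : Finset S, t.card ≤ s.card ∧ φ '' (t : Set S) = s := by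
    choose f hf using fun a : s => hsub a.2
    refine ⟨Finset.univ.image f, Finset.card_image_le.trans (by simp), ?_⟩
    ext a
    constructor
    · rintro ⟨b, hb, rfl⟩
      obtain ⟨c, -, rfl⟩ := Finset.mem_image.1 hb
      rw [hf]
      exact c.2
    · intro ha
      exact ⟨f ⟨a, ha⟩, Finset.mem_coe.2 (Finset.mem_image_of_mem _ (Finset.mem_univ _)), hf _⟩
  rw [← ht, ← Ideal.map_span] at hp
  have h2 := Ideal.height_le_card_of_mem_minimalPrimes_span_finset (hφ.comap_mem_minimalPrimes hp)
  have h3 : ((s.card + 1 : ℕ) : ℕ∞) ≤ (s.card : ℕ) := (h1.trans h2).trans (by exact_mod_cast htcard)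
  have : s.card + 1 ≤ s.card := by exact_mod_cast h3
  omega

theorem IsLocallyCM.height_le_of_isRegIdeal (hA : IsLocallyCM A) {n : ℕ} {J p : Ideal A}
    (hJ : IsRegIdeal n J) (hp : p ∈ J.minimalPrimes) : p.height ≤ n := by
  obtain ⟨s, hs, rfl⟩ := hJ.exists_finset
  exact (hA.height_le hp).trans (by exact_mod_cast hs)

theorem IsLocallyCM.finite_minimalPrimes (hA : IsLocallyCM A) {n : ℕ} {J : Ideal A}
    (hJ : IsRegIdeal n J) : J.minimalPrimes.Finite := by
  obtain ⟨F, hF⟩ := hJ.exists_descent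
  obtain ⟨S, _, φ, _, -, hφ, hr⟩ := hA F
  obtain ⟨J₀, -, rfl⟩ := hF S φ hφ hr
  exact hφ.finite_minimalPrimes J₀

/-- Unmixedness of ideals generated by regular sequences. -/
theorem IsLocallyCM.mem_minimalPrimes_of_colon (hA : IsLocallyCM A) {n : ℕ} {J : Ideal A}
    (hJ : IsRegIdeal n J) {g : A} {p : Ideal A} (hp : p ∈ (J.colon {g}).minimalPrimes) :
    p ∈ J.minimalPrimes := by
  classical
  obtain ⟨F, hF⟩ := hJ.exists_descent
  obtain ⟨S, _, φ, _, hS, hφ, hr⟩ := hA (insert g F)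
  obtain ⟨J₀, hJ₀, rfl⟩ := hF S φ hφ fun f hf => hr f (Finset.mem_insert_of_mem hf)
  obtain ⟨g, rfl⟩ := hr g (Finset.mem_insert_self g F)
  rw [hφ.colon_map] at hp
  -- The contraction of `p` is minimal over `(J₀ : g)`, hence associated to `J₀`, hence minimal over
  -- `J₀` as `S` is Cohen-Macaulay; `p` is its extension.
  have hq := hφ.comap_mem_minimalPrimes hp
  have := hq.isPrime
  obtain ⟨x, hx⟩ := Submodule.exists_eq_colon_of_mem_minimalPrimes hq
  rw [← hφ.map_comap_of_mem_minimalPrimes hp]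
  exact hφ.map_mem_minimalPrimes (hS.mem_minimalPrimes hJ₀ hx)

theorem IsLocallyCM.regularMod (hA : IsLocallyCM A) {n : ℕ} {J : Ideal A} (hJ : IsRegIdeal n J)
    {z : A} (hz : ∀ p ∈ J.minimalPrimes, z ∉ p) : RegularMod J z := by
  intro g hg
  by_contra hgJ
  have hne : J.colon {g} ≠ ⊤ := fun h => hgJ (by
    rw [Ideal.eq_top_iff_one, Submodule.mem_colon_singleton, one_smul] at h
    exact h)
  obtain ⟨p, hp⟩ := Ideal.nonempty_minimalPrimes hne
  exact hz p (hA.mem_minimalPrimes_of_colon hJ hp)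
    (hp.le (by rwa [Submodule.mem_colon_singleton]))

/-- The finitely many minimal primes of `J` have height at most `n`, so none contains an ideal of
height `n + 1`; prime avoidance supplies the next element. -/
theorem IsLocallyCM.exists_isRegIdeal (hA : IsLocallyCM A) {a : Ideal A} {n : ℕ}
    (hn : (n : ℕ∞) ≤ a.height) : ∃ J ≤ a, IsRegIdeal n J := by
  induction n with
  | zero => exact ⟨⊥, bot_le, .bot⟩
  | succ n ih =>
    obtain ⟨J, hJa, hJ⟩ := ih (le_trans (by simp) hn)
    have hsub : ¬ (a : Set A) ⊆ ⋃ p ∈ J.minimalPrimes, (p : Set A) := by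
      intro hsub
      obtain ⟨p, hp, hle⟩ := (Ideal.subset_union_prime_finite (f := id)
        (hA.finite_minimalPrimes hJ) ⊤ ⊤ fun p hp _ _ => hp.isPrime).1 hsub
      have h1 := (hn.trans (Ideal.height_mono hle)).trans (hA.height_le_of_isRegIdeal hJ hp)
      have : n + 1 ≤ n := by exact_mod_cast h1
      omega
    obtain ⟨z, hza, hz⟩ := Set.not_subset.1 hsub
    exact ⟨_, sup_le hJa ((Ideal.span_singleton_le_iff_mem _).2 hza), .step z hJ
      (hA.regularMod hJ fun p hp hzp => hz (Set.mem_biUnion hp hzp))⟩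

/-- Prime avoidance for the cosets of an ideal. -/
theorem exists_add_notMem {T : Set (Ideal A)} (hT : T.Finite) (hprime : ∀ p ∈ T, p.IsPrime)
    (hinc : ∀ p ∈ T, ∀ q ∈ T, p ≤ q → p = q) (x : A) (I : Ideal A)
    (h : ∀ p ∈ T, ¬ Ideal.span {x} ⊔ I ≤ p) : ∃ w ∈ I, ∀ p ∈ T, x + w ∉ p := by
  classical
  let T₀ : Finset (Ideal A) := hT.toFinset.filter fun p => x ∉ p
  -- `w` is taken in `K`, hence in every `p` missing `x`, and outside every `p` containing `x`.
  -- Incomparability of the primes makes this possible.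
  let K : Ideal A := I * ∏ p ∈ T₀, p
  have hsub : ¬ (K : Set A) ⊆ ⋃ p ∈ {p ∈ T | x ∈ p}, (p : Set A) := by
    intro hsub
    obtain ⟨p, ⟨hp, hxp⟩, hle⟩ := (Ideal.subset_union_prime_finite (f := id)
      (hT.subset (Set.sep_subset T fun p => x ∈ p)) ⊤ ⊤ fun p hp _ _ => hprime p hp.1).1 hsub
    have hpp := hprime p hp
    rcases (Ideal.IsPrime.mul_le hpp).1 hle with h1 | h1
    · exact h p hp (sup_le ((Ideal.span_singleton_le_iff_mem _).2 hxp) h1)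
    · obtain ⟨q, hq, hqp⟩ := (Ideal.IsPrime.prod_le hpp).1 h1
      obtain ⟨hqT, hxq⟩ := Finset.mem_filter.1 hq
      exact hxq (hinc q (hT.mem_toFinset.1 hqT) p hp hqp ▸ hxp)
  obtain ⟨w, hw, hwT⟩ := Set.not_subset.1 hsub
  refine ⟨w, Ideal.mul_le_left hw, fun p hp hxw => ?_⟩
  by_cases hxp : x ∈ p
  · exact hwT (Set.mem_biUnion ⟨hp, hxp⟩ ((Ideal.add_mem_iff_right p hxp).1 hxw))
  · have hwp : w ∈ p := (Ideal.mul_le_right.trans ((Ideal.prod_le_inf).trans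
      (Finset.inf_le (Finset.mem_filter.2 ⟨hT.mem_toFinset.2 hp, hxp⟩)))) hw
    exact hxp ((Ideal.add_mem_iff_left p hwp).1 hxw)

/-- The given generators need not form a regular sequence, but adding to `x` an element of the ideal
of the later ones keeps the ideal and, by the height hypothesis, can avoid the minimal primes of
`J`. -/
theorem IsLocallyCM.isRegIdeal_sup_ofList (hA : IsLocallyCM A) (l : List A) {n : ℕ} {J : Ideal A}
    (hJ : IsRegIdeal n J) (h : ((n + l.length : ℕ) : ℕ∞) ≤ (J ⊔ Ideal.ofList l).height) :
    IsRegIdeal (n + l.length) (J ⊔ Ideal.ofList l) := by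
  induction l generalizing n J with
  | nil => simpa using hJ
  | cons x l ih =>
    obtain ⟨w, hw, hwT⟩ := exists_add_notMem (hA.finite_minimalPrimes hJ)
      (fun p hp => hp.isPrime) (fun p hp q hq hpq => le_antisymm hpq (hq.2 hp.1 hpq)) x
      (Ideal.ofList l) (fun p hp hle => by
        have h1 : J ⊔ Ideal.ofList (x :: l) ≤ p := by
          rw [Ideal.ofList_cons]
          exact sup_le hp.le hle
        have h2 := (h.trans (Ideal.height_mono h1)).trans (hA.height_le_of_isRegIdeal hJ hp)
        have h3 : n + (x :: l).length ≤ n := by exact_mod_cast h2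
        rw [List.length_cons] at h3
        omega)
    have heq : J ⊔ Ideal.ofList (x :: l) = (J ⊔ Ideal.span {x + w}) ⊔ Ideal.ofList l := by
      rw [Ideal.ofList_cons, sup_assoc]
      congr 1
      refine le_antisymm (sup_le ?_ le_sup_right) (sup_le ?_ le_sup_right)
      · rw [Ideal.span_singleton_le_iff_mem]
        have h1 := (Ideal.span {x + w} ⊔ Ideal.ofList l).sub_mem
          (Ideal.mem_sup_left (Ideal.mem_span_singleton_self (x + w))) (Ideal.mem_sup_right hw)
        rwa [add_sub_cancel_right] at h1
      · rw [Ideal.span_singleton_le_iff_mem]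
        exact Ideal.add_mem _ (Ideal.mem_sup_left (Ideal.mem_span_singleton_self x))
          (Ideal.mem_sup_right hw)
    have hlen : n + (x :: l).length = n + 1 + l.length := by rw [List.length_cons]; omega
    rw [heq, hlen] at h ⊢
    exact ih (.step _ hJ (hA.regularMod hJ hwT)) h

end Locally

end NonNoethCM

namespace NonNoethCM

universe u

/-! ### Koszul grade and height -/

section Grade

theorem IsRegIdeal.le_koszulGrade {A : Type*} [CommRing A] {n : ℕ} {J a : Ideal A}
    (hJ : IsRegIdeal n J) (h : J ≤ a) : (n : ℕ∞) ≤ koszulGrade a A := by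
  obtain ⟨s, -, hs⟩ := hJ.exists_finset
  obtain ⟨r, y, hy⟩ := Submodule.fg_iff_exists_fin_generating_family.1 ⟨s, hs⟩
  have hv : KoszulVanish y ⊥ (n + 0) := hJ.koszulVanish_bot hy.ge (koszulVanish_zero y J)
  refine ((le_koszulGradeSeq_iff y n).2 hv).trans ?_
  exact le_iSup₂_of_le r y (le_iSup_of_le (fun k => h (hy ▸ Ideal.subset_span ⟨k, rfl⟩)) le_rfl)

/-- The map need only preserve colons, so the lemma also serves for `S → A → A_p`. -/
theorem KoszulVanish.le_height {S A : Type*} [CommRing S] [IsNoetherianRing S] [CommRing A]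
    {φ : S →+* A} (hφ : PreservesColon φ) {r n : ℕ} {y : Fin r → S} {a : Ideal A}
    (hy : ∀ j, φ (y j) ∈ a) (h : KoszulVanish (fun j => φ (y j)) ⊥ n) :
    (n : ℕ∞) ≤ a.height := by
  obtain ⟨J, hJ, hJr⟩ := KoszulVanish.exists_isRegIdeal hφ (I := ⊥) (m := 0) (n := n) (y := y)
    (by rw [Ideal.map_bot]; exact .bot) (by rwa [Ideal.map_bot])
  rw [zero_add] at hJr
  refine hJr.le_height_of_le (hJ.trans (sup_le (by simp) ?_))
  rw [Ideal.map_span, Ideal.span_le]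
  rintro _ ⟨_, ⟨j, rfl⟩, rfl⟩
  exact hy j

variable {A : Type u} [CommRing A]

theorem IsLocallyCM.height_eq_koszulGrade (hA : IsLocallyCM A) (a : Ideal A) :
    a.height = koszulGrade a A := by
  classical
  refine le_antisymm (ENat.forall_natCast_le_iff_le.1 fun n hn => ?_) ?_
  · obtain ⟨J, hJ, hJr⟩ := hA.exists_isRegIdeal hn
    exact hJr.le_koszulGrade hJ
  · refine iSup_le fun r => iSup_le fun y => iSup_le fun hy =>
      ENat.forall_natCast_le_iff_le.1 fun n hn => ?_
    rw [le_koszulGradeSeq_iff] at hn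
    obtain ⟨S, _, φ, _, -, hφ, hr⟩ := hA (Finset.univ.image y)
    choose w hw using fun j => hr (y j) (Finset.mem_image_of_mem y (Finset.mem_univ j))
    obtain rfl : (fun j => φ (w j)) = y := funext hw
    exact hn.le_height hφ.preservesColon hy

theorem IsLocallyCM.isGlazCM (hA : IsLocallyCM A) : IsGlazCM A := by
  classical
  intro p hp
  have hcol : PreservesColon (algebraMap A (Localization.AtPrime p)) :=
    preservesColon_of_isLocalization p.primeCompl
  refine le_antisymm (ENat.forall_natCast_le_iff_le.1 fun n hn => ?_) ?_
  · obtain ⟨J, hJ, hJr⟩ := hA.exists_isRegIdeal hn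
    exact (hJr.map hcol).le_koszulGrade (Ideal.map_mono hJ)
  · refine iSup_le fun r => iSup_le fun y => iSup_le fun hy =>
      ENat.forall_natCast_le_iff_le.1 fun n hn => ?_
    rw [le_koszulGradeSeq_iff] at hn
    -- Denominators are units of `A_p`; rescaling by them leaves a sequence from `p`, which lifts to
    -- some `S`.
    choose x hx using fun j => (IsLocalization.mem_map_algebraMap_iff p.primeCompl _).1 (hy j)
    obtain ⟨S, _, φ, _, -, hφ, hr⟩ := hA (Finset.univ.image fun j => ((x j).1 : A))
    choose w hw using fun j => hr _ (Finset.mem_image_of_mem _ (Finset.mem_univ j))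
    have hn' := hn.units_mul fun j =>
      (IsLocalization.map_units (Localization.AtPrime p) (x j).2).unit
    have heq : (fun j => ((IsLocalization.map_units (Localization.AtPrime p) (x j).2).unit :
        Localization.AtPrime p) * y j) =
          fun j => ((algebraMap A (Localization.AtPrime p)).comp φ) (w j) := by
      funext j
      rw [IsUnit.unit_spec, mul_comm, hx, RingHom.comp_apply, hw]
    rw [heq] at hn'
    have h1 := hn'.le_height (hcol.comp hφ.preservesColon)
      (a := p.map (algebraMap A (Localization.AtPrime p))) fun j => by
        rw [RingHom.comp_apply, hw]
        exact Ideal.mem_map_of_mem _ (x j).1.2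
    rwa [IsLocalization.height_map_of_disjoint p.primeCompl p
      (Set.disjoint_left.2 fun s hs hsp => hs hsp)] at h1

theorem torsionOf_mk (I : Ideal A) (g : A) :
    Ideal.torsionOf A (A ⧸ I) (Ideal.Quotient.mk I g) = I.colon {g} := by
  ext s
  rw [Ideal.mem_torsionOf_iff, Submodule.mem_colon_singleton, ← Ideal.Quotient.eq_zero_iff_mem]
  rfl

theorem IsLocallyCM.isWeakBourbakiUnmixed (hA : IsLocallyCM A) : IsWeakBourbakiUnmixed A := by
  intro a ha hht
  obtain ⟨s, hs, hsa⟩ := Submodule.FG.exists_span_finset_card_eq_spanFinrank ha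
  have hl : Ideal.ofList s.toList = a := by
    rw [← hsa, Ideal.ofList]
    simp
  have hreg : IsRegIdeal (0 + s.toList.length) a := by
    have h := hA.isRegIdeal_sup_ofList s.toList IsRegIdeal.bot
    rw [bot_sup_eq, hl] at h
    refine h ?_
    rw [zero_add, Finset.length_toList, hs]
    exact hht
  refine Set.Subset.antisymm (fun p hp => ⟨Ideal.Quotient.mk a 1, ?_⟩) ?_
  · rw [torsionOf_mk]
    have h1 : a.colon {1} = a := by
      ext t
      simp [Submodule.mem_colon_singleton]
    rwa [h1]
  · rintro p ⟨m, hm⟩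
    obtain ⟨g, rfl⟩ := Ideal.Quotient.mk_surjective m
    rw [torsionOf_mk] at hm
    exact hA.mem_minimalPrimes_of_colon hreg hm

end Grade

/-! ### Strong parameter sequences -/

section Cech

variable {A : Type*} [CommRing A]

theorem Subsets.erase_subset {r i : ℕ} (J : Subsets r (i + 1)) (j : {j : Fin r // j ∈ J.1}) :
    (J.erase j).1 ⊆ J.1 := Finset.erase_subset j.1 J.1

theorem cechD_apply {r i : ℕ} (x : Fin r → A) (b : CechCochain x i) (J : Subsets r (i + 1)) :
    cechD x i b J = ∑ j : {j : Fin r // j ∈ J.1},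
      (-1 : A) ^ position J.1 j.1 • cechRes x (J.erase_subset j) (b (J.erase j)) := by
  rw [cechD, LinearMap.pi_apply, LinearMap.sum_apply]
  rfl

theorem cechD_single {r i : ℕ} (x : Fin r → A) (J : Subsets r (i + 1)) (j : {j : Fin r // j ∈ J.1})
    (v : CechLoc x (J.erase j).1) :
    cechD x i (Pi.single (J.erase j) ((-1 : A) ^ position J.1 j.1 • v)) J =
      cechRes x (J.erase_subset j) v := by
  classical
  rw [cechD_apply, Finset.sum_eq_single j]
  · rw [Pi.single_eq_same, map_smul, smul_smul, ← mul_pow]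
    simp
  · intro k _ hkj
    rw [Pi.single_eq_of_ne, map_zero, smul_zero]
    intro he
    have h1 : J.1.erase k.1 = J.1.erase j.1 := congrArg Subtype.val he
    exact hkj (Subtype.ext ((Finset.erase_inj J.1 k.2).1 h1))
  · simp

theorem exists_cechRes_eq {r : ℕ} (x : Fin r → A) {I J : Finset (Fin r)} (hIJ : I ⊆ J) (b d : A)
    (hd : ∃ n, d ∣ (∏ k ∈ I, x k) ^ n) :
    ∃ v : CechLoc x I, algebraMap A (CechLoc x J) d * cechRes x hIJ v = algebraMap A _ b := by
  obtain ⟨n, hn⟩ := hd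
  have hu : IsUnit (algebraMap A (CechLoc x I) d) := by
    refine isUnit_of_dvd_unit (map_dvd _ hn) ?_
    rw [map_pow]
    exact (IsLocalization.Away.algebraMap_isUnit _).pow n
  obtain ⟨c, hc⟩ := hu.exists_right_inv
  refine ⟨algebraMap A _ b * c, ?_⟩
  rw [← (cechRes x hIJ).commutes d, ← map_mul, mul_left_comm, hc, mul_one, AlgHom.commutes]

/-- A top cochain is a fraction `a / P ^ n` with `P` the product of all `x k`. If `s ^ N * x_last ^
(c * N) = ∑ b i * x i ^ n`, then `s ^ N * a / P ^ n` is a sum of fractions whose `i`-th term needs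
no inversion of `x i`, that is, a coboundary. So a power of `s ∉ p` kills each class. -/
theorem subsingleton_localized_cechCohomology {r : ℕ} (x : Fin (r + 1) → A) (p : Ideal A)
    [p.IsPrime] {s : A} (hs : s ∉ p) (c : ℕ)
    (h : s * x (Fin.last r) ^ c ∈ Ideal.span (Set.range fun i : Fin r => x i.castSucc)) :
    Subsingleton (LocalizedModule p.primeCompl (CechCohomology x (r + 1))) := by
  classical
  let J₀ : Subsets (r + 1) (r + 1) := ⟨Finset.univ, by simp⟩
  have hJ₀ : ∀ J : Subsets (r + 1) (r + 1), J = J₀ := fun J =>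
    Subtype.ext ((Finset.card_eq_iff_eq_univ J.1).1 (by simpa using J.2))
  rw [LocalizedModule.subsingleton_iff]
  intro q
  obtain ⟨⟨w, hw⟩, rfl⟩ := Submodule.Quotient.mk_surjective _ q
  let P : A := ∏ k, x k
  obtain ⟨⟨a, ⟨_, n, rfl⟩⟩, ha⟩ := IsLocalization.surj (Submonoid.powers P) (w J₀)
  simp only at ha
  obtain ⟨N, hN⟩ := Ideal.exists_pow_le_of_le_radical_of_fg
    (I := Ideal.span (Set.range fun i : Fin r => x i.castSucc))
    (J := Ideal.span (Set.range fun i : Fin r => x i.castSucc ^ n))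
    (Ideal.span_le.2 (by
      rintro _ ⟨i, rfl⟩
      exact ⟨n, Ideal.subset_span ⟨i, rfl⟩⟩))
    (Submodule.fg_span (Set.finite_range _))
  have hmem := hN (Ideal.pow_mem_pow h N)
  rw [mul_pow, ← pow_mul] at hmem
  obtain ⟨b, hb⟩ := Ideal.mem_span_range_iff_exists_fun.1 hmem
  let m := c * N
  let j : Fin r → {j : Fin (r + 1) // j ∈ J₀.1} := fun i => ⟨i.castSucc, Finset.mem_univ _⟩
  have hPQ : ∀ i : Fin r, x i.castSucc * ∏ k ∈ (J₀.erase (j i)).1, x k = P := fun i =>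
    Finset.mul_prod_erase Finset.univ x (Finset.mem_univ i.castSucc)
  have hlast : ∀ i : Fin r, x (Fin.last r) ∣ ∏ k ∈ (J₀.erase (j i)).1, x k := fun i =>
    Finset.dvd_prod_of_mem x (Finset.mem_erase.2 ⟨(Fin.castSucc_lt_last i).ne', Finset.mem_univ _⟩)
  -- `v i` is `b i * a / ((P / x i) ^ n * x_last ^ m)`, a fraction in the localization that omits `x
  -- i`.
  choose v hv using fun i : Fin r => exists_cechRes_eq x
    (J₀.erase_subset (j i)) (b i * a)
    ((∏ k ∈ (J₀.erase (j i)).1, x k) ^ n * x (Fin.last r) ^ m)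
    ⟨n + m, by rw [pow_add]; exact mul_dvd_mul_left _ (pow_dvd_pow_of_dvd (hlast i) m)⟩
  refine ⟨s ^ N, fun hsp => hs (Ideal.IsPrime.mem_of_pow_mem ‹_› N hsp), ?_⟩
  rw [← Submodule.Quotient.mk_smul, Submodule.Quotient.mk_eq_zero]
  change s ^ N • w ∈ LinearMap.range (cechD x r)
  refine ⟨∑ i, Pi.single (J₀.erase (j i)) ((-1 : A) ^ position J₀.1 (j i).1 • v i), ?_⟩
  funext J
  rw [hJ₀ J, map_sum, Finset.sum_apply, Finset.sum_congr rfl fun i _ => cechD_single x J₀ (j i) (v i),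
    Pi.smul_apply, Algebra.smul_def]
  have hunit : IsUnit (algebraMap A (CechLoc x J₀.1) (P ^ n * x (Fin.last r) ^ m)) := by
    have hP : IsUnit (algebraMap A (CechLoc x J₀.1) P) := IsLocalization.Away.algebraMap_isUnit _
    have hl : x (Fin.last r) ∣ P := Finset.dvd_prod_of_mem x (Finset.mem_univ _)
    rw [map_mul, map_pow, map_pow]
    exact (hP.pow n).mul ((isUnit_of_dvd_unit (map_dvd _ hl) hP).pow m)
  refine hunit.mul_left_cancel ?_
  have hterm : ∀ i : Fin r, algebraMap A (CechLoc x J₀.1) (P ^ n * x (Fin.last r) ^ m) *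
      cechRes x (J₀.erase_subset (j i)) (v i) =
        algebraMap A _ (b i * x i.castSucc ^ n * a) := by
    intro i
    have h1 : P ^ n * x (Fin.last r) ^ m = x i.castSucc ^ n *
        ((∏ k ∈ (J₀.erase (j i)).1, x k) ^ n * x (Fin.last r) ^ m) := by
      rw [← hPQ i, mul_pow, mul_assoc]
    rw [h1, map_mul, mul_assoc, hv i, ← map_mul]
    congr 1
    ring
  rw [Finset.mul_sum, Finset.sum_congr rfl fun i _ => hterm i, ← map_sum, ← Finset.sum_mul, hb,
    map_mul, ← ha]
  simp only [map_mul, map_pow]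
  ring

/-- `x` is nilpotent in `(A ⧸ I)_p`: a prime over `I` disjoint from the monoid generated by `x` and
the complement of `p` would lie in `p` and miss `x`. -/
theorem exists_mul_pow_mem_of_mem_minimalPrimes {I p : Ideal A} (hp : p ∈ I.minimalPrimes) {x : A}
    (hx : x ∈ p) : ∃ s ∉ p, ∃ c : ℕ, s * x ^ c ∈ I := by
  have := hp.isPrime
  by_contra hcon
  push Not at hcon
  obtain ⟨q, hq, hIq, hdis⟩ := Ideal.exists_le_prime_disjoint I (p.primeCompl ⊔ Submonoid.powers x)
    (Set.disjoint_right.2 fun t ht htI => by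
      obtain ⟨s, hs, _, ⟨c, rfl⟩, rfl⟩ := Submonoid.mem_sup.1 ht
      exact hcon s hs c htI)
  have hqp : q ≤ p := fun t ht => by
    by_contra htp
    exact Set.disjoint_left.1 hdis ht ((le_sup_left : p.primeCompl ≤ _) htp)
  exact Set.disjoint_left.1 hdis (hp.2 ⟨hq, hIq⟩ hqp hx)
    ((le_sup_right : Submonoid.powers x ≤ _) (Submonoid.mem_powers x))

end Cech

/-! ### Strong parameter sequences are regular sequences -/

section HamiltonMarley

variable {A : Type u} [CommRing A]

/-- The ideal generated by the first `i` members of a sequence. -/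
def initialIdeal {r : ℕ} (x : Fin r → A) (i : ℕ) : Ideal A :=
  Ideal.span {a | ∃ k : Fin r, k.1 < i ∧ x k = a}

theorem initialIdeal_eq_span_range {r : ℕ} (x : Fin r → A) {i : ℕ} (h : i ≤ r) :
    initialIdeal x i = Ideal.span (Set.range fun k : Fin i => x (Fin.castLE h k)) := by
  unfold initialIdeal
  congr 1
  ext a
  constructor
  · rintro ⟨k, hk, rfl⟩
    exact ⟨⟨k.1, hk⟩, rfl⟩
  · rintro ⟨k, rfl⟩
    exact ⟨Fin.castLE h k, k.2, rfl⟩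

theorem initialIdeal_succ {r : ℕ} (x : Fin r → A) (i : Fin r) :
    initialIdeal x (i.1 + 1) = initialIdeal x i.1 ⊔ Ideal.span {x i} := by
  unfold initialIdeal
  rw [← Ideal.span_union]
  congr 1
  ext a
  constructor
  · rintro ⟨k, hk, rfl⟩
    rcases Nat.lt_succ_iff_lt_or_eq.1 hk with hlt | heq
    · exact Or.inl ⟨k, hlt, rfl⟩
    · exact Or.inr (by rw [Fin.ext heq]; rfl)
  · rintro (⟨k, hk, rfl⟩ | rfl)
    · exact ⟨k, hk.trans (Nat.lt_succ_self _), rfl⟩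
    · exact ⟨i, Nat.lt_succ_self _, rfl⟩

theorem ofList_take_ofFn {r : ℕ} (x : Fin r → A) (i : ℕ) :
    Ideal.ofList ((List.ofFn x).take i) = initialIdeal x i := by
  unfold initialIdeal Ideal.ofList
  congr 1
  ext a
  simp only [Set.mem_ofPred_eq, List.mem_take_iff_getElem, List.length_ofFn, List.getElem_ofFn]
  constructor
  · rintro ⟨k, hk, rfl⟩
    exact ⟨⟨k, by omega⟩, by simp only; omega, rfl⟩
  · rintro ⟨k, hk, rfl⟩
    exact ⟨k.1, by omega, rfl⟩

theorem IsLocallyCM.regularMod_of_isStrongParameterSeq (hA : IsLocallyCM A) {r : ℕ} {x : Fin r → A}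
    (hx : IsStrongParameterSeq x) (i : Fin r) (hi : IsRegIdeal i.1 (initialIdeal x i.1)) :
    RegularMod (initialIdeal x i.1) (x i) := by
  refine hA.regularMod hi fun p hp hxp => ?_
  have := hp.isPrime
  have hpar := hx (i.1 + 1) i.2 (by omega)
  have hle : initialIdeal x (i.1 + 1) ≤ p := by
    rw [initialIdeal_succ]
    exact sup_le hp.le ((Ideal.span_singleton_le_iff_mem _).2 hxp)
  have hnt := hpar.cech_nontrivial p (by rwa [← initialIdeal_eq_span_range])
  obtain ⟨s, hs, c, hsc⟩ := exists_mul_pow_mem_of_mem_minimalPrimes hp hxp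
  rw [initialIdeal_eq_span_range x i.2.le] at hsc
  exact not_subsingleton_iff_nontrivial.2 hnt
    (subsingleton_localized_cechCohomology (fun k => x (Fin.castLE i.2 k)) p hs c hsc)

theorem IsLocallyCM.isHamiltonMarleyCM (hA : IsLocallyCM A) : IsHamiltonMarleyCM A := by
  intro r x hr hx
  have hreg : ∀ i ≤ r, IsRegIdeal i (initialIdeal x i) := by
    intro i
    induction i with
    | zero =>
      intro _
      have : initialIdeal x 0 = ⊥ := by simp [initialIdeal]
      rw [this]
      exact .bot
    | succ i ih =>
      intro hi
      have h1 := ih (by omega)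
      rw [initialIdeal_succ x ⟨i, hi⟩]
      exact .step _ h1 (hA.regularMod_of_isStrongParameterSeq hx ⟨i, hi⟩ h1)
  refine (RingTheory.Sequence.isRegular_iff _ _).2
    ⟨(RingTheory.Sequence.isWeaklyRegular_iff _ _).2 fun i hi => ?_, fun h => ?_⟩
  · rw [isSMulRegular_quotient_iff, ofList_take_ofFn, List.getElem_ofFn]
    rw [List.length_ofFn] at hi
    exact hA.regularMod_of_isStrongParameterSeq hx ⟨i, hi⟩ (hreg i hi.le)
  -- Properness comes from the full segment, a parameter sequence because `r` is positive.
  · refine (hx r le_rfl hr).span_ne_top ?_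
    rw [← initialIdeal_eq_span_range, ← ofList_take_ofFn, List.take_of_length_le (by simp), h]
    simp

end HamiltonMarley

end NonNoethCM

theorem theorem4p1 {R : Type*} [CommRing R] [IsNoetherianRing R]
    (hR : NonNoethCM.IsClassicalCM R) :
    NonNoethCM.IsCMFor (MvPolynomial ℕ R) {p | p.IsPrime} ∧
    NonNoethCM.IsCMFor (MvPolynomial ℕ R) Set.univ ∧
    NonNoethCM.IsGlazCM (MvPolynomial ℕ R) ∧
    NonNoethCM.IsCMFor (MvPolynomial ℕ R) {a | a.FG} ∧
    NonNoethCM.IsHamiltonMarleyCM (MvPolynomial ℕ R) ∧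
    NonNoethCM.IsWeakBourbakiUnmixed (MvPolynomial ℕ R) ∧
    NonNoethCM.IsCMFor (MvPolynomial ℕ R) {m | m.IsMaximal} := by
  have hA := NonNoethCM.isLocallyCM_mvPolynomial hR.isGradeCM
  exact ⟨fun a _ => hA.height_eq_koszulGrade a, fun a _ => hA.height_eq_koszulGrade a,
    hA.isGlazCM, fun a _ => hA.height_eq_koszulGrade a, hA.isHamiltonMarleyCM,
    hA.isWeakBourbakiUnmixed, fun a _ => hA.height_eq_koszulGrade a⟩
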